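/- Let $n\ge 1$ and let $\mathbb P$ be the law of the Poisson random field with intensity $1$ in $\mathbb R^n$: a probability measure on the set of locally finite subsets $\sigma\subset\mathbb R^n$ such that the restrictions $\sigma\cap V$ and $\sigma\cap W$ to disjoint Borel sets $V,W$ are independent, and, for every bounded Borel set $V$, the number $|\sigma\cap V|$ is Poisson distributed with mean $\mathrm{vol}(V)$, and, conditionally on $|\sigma\cap V|=m$ (if $\mathrm{vol}(V)>0$), the set $\sigma\cap V$ is distributed as $\{x_1,\dots,x_m\}$ with $x_1,\dots,x_m$ independent and uniform in $V$. For $N>0$ let $V_N=[-N,N]^n$ and $\sigma_N=\sigma\cap V_N$. For a finite set $\tau\subset V_N$ let $d(\tau)$ be the minimal (Euclidean) distance between two different points of $\tau$ (put $d(\tau)=0$ if $\tau$ has at most one point) and $$\Delta_N(\tau)=\frac{1}{(2N)^n}\,\mathrm{vol}\Bigl(V_N\cap\bigcup_{x\in\tau}B\bigl(x,\tfrac12 d(\tau)\bigr)\Bigr),$$ where $B(x,r)$ is the ball of radius $r$ centered at $x$. Fix $\varepsilon\in(0,\tfrac12)$ and for $0<\nu<1$ let $$\Delta_{N,\nu}(\sigma)=\max\bigl\{\Delta_N(\tau):\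 \tau\subset\sigma_N,\ \nu|\sigma_N|-|\sigma_N|^{1/2+\varepsilon}\le|\tau|\le\nu|\sigma_N|+|\sigma_N|^{1/2+\varepsilon}\bigr\}.$$ Then there is a (non-random) function $\mathcal D$ such that, with $\mathbb P$-probability $1$, $$\liminf_{N\to\infty}\Delta_{N,\nu}(\sigma)=\mathcal D(\nu)\qquad\text{for every }\nu,\ 0<\nu<1,$$ where $N\to\infty$ through the real numbers. Let $v_n(d)$ be the volume of a ball of radius $d$ in $\mathbb R^n$. Then $\mathcal D$ has the following properties. i) Let $\nu_1(d)=1-\frac12 v_n(d)$. For every $d>0$ with $\nu_1(d)>0$, $$\mathcal D(\nu_1(d))\ \ge\ 2^{-n}v_n(d)\,\nu_1(d).$$ In particular, for $d=d_n>0$ with $v_n(d_n)=1$ we have $\nu_1(d_n)=\frac12$, and so $\mathcal D(\tfrac12)\ge 2^{-n-1}$. ii) Let $\nu_2(d)=1-\frac12 v_n(d)e^{-2v_n(d)}$. For every $d>0$, $$\mathcal D(\nu_2(d))\ \le\ 2^{-n}v_n(d)\,\nu_2(d).$$ iii) Let $\nu_3(d)=1-\frac13 v_n(d)-\frac16 v_n(d)e^{-v_n(d)}$.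 For every $d>0$ with $\nu_3(d)>0$, $$\mathcal D(\nu_3(d))\ \ge\ 2^{-n}v_n(d)\,\nu_3(d).$$ -/

import Mathlib

open MeasureTheory ProbabilityTheory Filter Set

noncomputable section

namespace RandomPacking

/-- Euclidean space of dimension `n`. -/
abbrev Space (n : ℕ) : Type := EuclideanSpace ℝ (Fin n)

/-- The locally finite subsets of `ℝⁿ` (they are automatically countable). -/
def Config (n : ℕ) : Type :=
  {s : Set (Space n) // ∀ K : Set (Space n), Bornology.IsBounded K → (s ∩ K).Finite}

/-- The usual σ-algebra on configurations: the smallest one for which all the counting maps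
`σ ↦ |σ ∩ V|`, with `V` Borel, are measurable. -/
instance (n : ℕ) : MeasurableSpace (Config n) :=
  ⨆ (V : Set (Space n)) (_ : MeasurableSet V),
    MeasurableSpace.comap (fun σ : Config n => (σ.1 ∩ V).encard) ⊤

/-- The part `σ ∩ V` of a configuration `σ` in `V`. -/
def Config.restrict {n : ℕ} (V : Set (Space n)) (σ : Config n) : Config n :=
  ⟨σ.1 ∩ V, fun K hK => (σ.2 K hK).subset fun _ hx => ⟨hx.1.1, hx.2⟩⟩

/-- The configuration `{x₁, …, xₘ}` of the entries of a tuple. -/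
def Config.ofTuple {n m : ℕ} (x : Fin m → Space n) : Config n :=
  ⟨Set.range x, fun _ _ => (Set.finite_range x).subset Set.inter_subset_left⟩

/-- The event that there are exactly `m` points in `V`. -/
def countEvent {n : ℕ} (V : Set (Space n)) (m : ℕ) : Set (Config n) :=
  {σ | (σ.1 ∩ V).encard = m}

/-- `P` is the law of a Poisson random field with intensity `lam`. -/
structure IsPoissonField {n : ℕ} (lam : ℝ) (P : Measure (Config n)) : Prop where
  isProbabilityMeasure : IsProbabilityMeasure P
  /-- The parts of the configuration in disjoint sets are independent. -/
  indep : ∀ V W : Set (Space n), MeasurableSet V → MeasurableSet W → Disjoint V W →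
    IndepFun (Config.restrict V) (Config.restrict W) P
  /-- The number of points in a bounded set is Poisson distributed. -/
  count : ∀ V : Set (Space n), MeasurableSet V → Bornology.IsBounded V → ∀ m : ℕ,
    P (countEvent V m) = ENNReal.ofReal
      (Real.exp (-(lam * (volume V).toReal)) * (lam * (volume V).toReal) ^ m / m.factorial)
  /-- Given that there are `m` points in `V`, they form the set of entries of a tuple which is
  distributed on `V ^ m` according to the normalized Lebesgue measure. -/
  uniform : ∀ V : Set (Space n), MeasurableSet V → Bornology.IsBounded V → volume V ≠ 0 →
    ∀ (m : ℕ) (A : Set (Config n)), MeasurableSet A →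
      cond P (countEvent V m) (Config.restrict V ⁻¹' A) =
        volume {x : Fin m → Space n | (∀ i, x i ∈ V) ∧ Config.ofTuple x ∈ A} / volume V ^ m

/-- The cube with side `2 N` centered at the origin. -/
def box (n : ℕ) (N : ℝ) : Set (Space n) := {x | ∀ i, |x i| ≤ N}

/-- The geometric (sphere packing) density in the cube with side `2 N` of a set of points: the
fraction of the cube which is covered by the balls around those of the points that lie in the
cube, with radius one half of their minimal spacing. -/
def boxDensity {n : ℕ} (N : ℝ) (s : Set (Space n)) : ℝ :=
  (volume ((⋃ x ∈ s ∩ box n N, Metric.closedBall x ((s ∩ box n N).infsep / 2)) ∩ box n N)).toReal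
    / (2 * N) ^ n

/-- The largest density in the cube with side `2 N` of a subset `τ` of `σ` in that cube which
contains a fraction `ν` of the points, up to an error of `|σ_N| ^ (1 / 2 + ε)` points. -/
def decimatedDensity {n : ℕ} (ε ν N : ℝ) (σ : Config n) : ℝ :=
  sSup {δ : ℝ | ∃ τ : Set (Space n), τ ⊆ σ.1 ∩ box n N ∧
    ν * ((σ.1 ∩ box n N).ncard : ℝ) - ((σ.1 ∩ box n N).ncard : ℝ) ^ (1 / 2 + ε) ≤ (τ.ncard : ℝ) ∧
    (τ.ncard : ℝ) ≤ ν * ((σ.1 ∩ box n N).ncard : ℝ) + ((σ.1 ∩ box n N).ncard : ℝ) ^ (1 / 2 + ε) ∧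
    δ = boxDensity N τ}

/-- The volume of a ball of radius `r` in `ℝⁿ`. -/
def ballVol (n : ℕ) (r : ℝ) : ℝ := (volume (Metric.closedBall (0 : Space n) r)).toReal

def nu1 (n : ℕ) (d : ℝ) : ℝ := 1 - ballVol n d / 2

def nu2 (n : ℕ) (d : ℝ) : ℝ := 1 - ballVol n d / 2 * Real.exp (-2 * ballVol n d)

def nu3 (n : ℕ) (d : ℝ) : ℝ :=
  1 - ballVol n d / 3 - ballVol n d / 6 * Real.exp (-ballVol n d)

end RandomPacking

end

open scoped ENNReal NNReal Topology

namespace RandomPacking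

variable {n : ℕ}

/-! Everything is controlled by one function `ι`: the almost sure limit, per unit volume, of the
largest number of points of σ in the box whose distances all exceed `d`. Since `ι 0 = 1`, the box
holds about (2N)ⁿ points. If ν < ι(d), then for large N a fraction ν of the points can be chosen
with spacing at least `d`; if ν > ι(d), every admissible subset has spacing at most `d`. So the best
spacing tends to r(ν) = sup {d | ν ≤ ι(d)}. Balls of half that radius are disjoint and only a thin
boundary shell leaves the box, so the density converges to D(ν) = ν · vol B(r(ν)/2), as a genuine
limit and not only a liminf. The inequalities for `D` are then inequalities between `ι` and the
functions `nu1`, `nu2`, `nu3`.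

`ι` exists (`exists_packing_density`) because the packing number is subadditive over sets and
superadditive over sets more than `d` apart. Cutting space into cubes of side L, or into cubes of
side L - d with corridors between them, squeezes the count between sums of pairwise independent
variables, to which a strong law applies; the corridors cost a fraction that vanishes as L grows.

Two counts over random tuples bound `ι`; write v for the volume of a ball of radius `d`. Keeping
each point that has no earlier point within `d` gives a separated set of mean density (1 - e⁻ᵛ)/v
(`le_meanPacking`), which is at least `nu3`, hence at least `nu1`. In the other direction, a pair at
distance in (d', d] that is isolated from all other points contributes at most one point to a
`d`-packing, but both can be used at scale d'. Hence ι(d') exceeds ι(d) by at least the density of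
such pairs (`meanPacking_add_le`). This makes `ι` strictly decreasing and, for d' = 0, bounds it by
`nu2`. -/

/-! ### Measurability on the space of configurations -/

theorem measurable_encard_inter {V : Set (Space n)} (hV : MeasurableSet V) :
    Measurable fun σ : Config n => (σ.1 ∩ V).encard := by
  intro s _
  have h : MeasurableSpace.comap (fun σ : Config n => (σ.1 ∩ V).encard) ⊤ ≤
      (inferInstance : MeasurableSpace (Config n)) :=
    le_iSup₂ (f := fun (V : Set (Space n)) (_ : MeasurableSet V) =>
      MeasurableSpace.comap (fun σ : Config n => (σ.1 ∩ V).encard) ⊤) V hV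
  exact h _ ⟨s, trivial, rfl⟩

theorem measurable_config_of_encard {α : Type*} [mα : MeasurableSpace α] {f : α → Config n}
    (h : ∀ V, MeasurableSet V → Measurable fun a => ((f a).1 ∩ V).encard) : Measurable f := by
  rw [measurable_iff_comap_le]
  change MeasurableSpace.comap f (⨆ (V : Set (Space n)) (_ : MeasurableSet V), _) ≤ mα
  simp only [MeasurableSpace.comap_iSup, iSup_le_iff, MeasurableSpace.comap_comp]
  intro V hV
  have := (h V hV).comap_le
  exact this

theorem measurable_restrict {V : Set (Space n)} (hV : MeasurableSet V) :
    Measurable (Config.restrict V) := by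
  refine measurable_config_of_encard fun W hW => ?_
  have := measurable_encard_inter (hV.inter hW)
  simpa [Config.restrict, inter_assoc] using this

/-- A value may occur several times in the tuple; counting it only at its smallest index makes the
count a finite sum of indicators of measurable sets. -/
theorem encard_range_inter {m : ℕ} (x : Fin m → Space n) (V : Set (Space n)) :
    (range x ∩ V).encard =
      ∑ i, {y : Fin m → Space n | y i ∈ V ∧ ∀ j < i, y j ≠ y i}.indicator 1 x := by
  classical
  have h1 : range x ∩ V =
      x '' (↑(Finset.univ.filter fun i => x i ∈ V ∧ ∀ j < i, x j ≠ x i) : Set (Fin m)) := by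
    ext y
    simp only [mem_inter_iff, mem_range, Finset.coe_filter, Finset.mem_univ, true_and,
      mem_image, mem_ofPred_eq]
    constructor
    · rintro ⟨⟨i, rfl⟩, hV⟩
      have hne : (Finset.univ.filter fun j => x j = x i).Nonempty := ⟨i, by simp⟩
      have hm := Finset.min'_mem _ hne
      simp only [Finset.mem_filter, Finset.mem_univ, true_and] at hm
      refine ⟨_, ⟨by rwa [hm], fun j hj he => ?_⟩, hm⟩
      exact absurd (Finset.min'_le _ j (by simp [he, hm])) (not_le.2 hj)
    · rintro ⟨i, ⟨hi, -⟩, rfl⟩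
      exact ⟨⟨i, rfl⟩, hi⟩
  rw [h1, InjOn.encard_image, encard_coe_eq_coe_finsetCard, Finset.card_filter]
  · push_cast
    refine Finset.sum_congr rfl fun i _ => ?_
    simp [indicator_apply]
  · intro i hi j hj hij
    simp only [Finset.coe_filter, Finset.mem_univ, true_and, mem_ofPred_eq] at hi hj
    rcases lt_trichotomy i j with h | h | h
    · exact absurd hij (hj.2 i h)
    · exact h
    · exact absurd hij.symm (hi.2 j h)

theorem measurable_ofTuple {m : ℕ} :
    Measurable (Config.ofTuple : (Fin m → Space n) → Config n) := by
  refine measurable_config_of_encard fun V hV => ?_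
  simp only [Config.ofTuple, encard_range_inter]
  refine Finset.measurable_sum _ fun i _ => ?_
  refine measurable_const.indicator ?_
  refine (measurable_pi_apply i hV).inter ?_
  change MeasurableSet {x : Fin m → Space n | ∀ j < i, x j ≠ x i}
  simp only [ofPred_forall]
  refine MeasurableSet.iInter fun j => MeasurableSet.iInter fun _ => ?_
  exact (measurableSet_eq_fun (measurable_pi_apply j) (measurable_pi_apply i)).compl

theorem natCast_le_packingNumber_iff {X : Type*} [PseudoEMetricSpace X] {d : ℝ≥0} {s : Set X}
    {k : ℕ} : (k : ℕ∞) ≤ Metric.packingNumber d s ↔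
      ∃ x : Fin k → X, (∀ i, x i ∈ s) ∧ Function.Injective x ∧
        Pairwise fun i j => (d : ℝ≥0∞) < edist (x i) (x j) := by
  constructor
  · intro h
    obtain ⟨C, hCs, hC, hk⟩ : ∃ C ⊆ s, Metric.IsSeparated d C ∧ (k : ℕ∞) ≤ C.encard := by
      -- A supremum of extended naturals that is at least `k` is attained at level `k`: otherwise
      -- every separated set has at most `k - 1` points, and so does the supremum.
      by_contra! hcon
      rcases k with _ | k
      · exact absurd (hcon ∅ (empty_subset _) Metric.IsSeparated.empty) (by simp)
      · have : Metric.packingNumber d s ≤ k := by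
          refine iSup_le fun C => iSup₂_le fun hC hC' => ?_
          have := hcon C hC hC'
          push_cast at this
          exact Order.le_of_lt_add_one this
        have := h.trans this
        norm_cast at this
        omega
    obtain ⟨T, hT, hTk⟩ := exists_subset_encard_eq hk
    have hTf : T.Finite := finite_of_encard_eq_coe hTk
    have hcard : hTf.toFinset.card = k := by
      have := hTf.encard_eq_coe_toFinset_card
      rw [hTk] at this
      exact_mod_cast this.symm
    refine ⟨fun i => (hTf.toFinset.equivFinOfCardEq hcard).symm i, fun i => ?_, ?_, ?_⟩
    · exact hCs (hT (hTf.mem_toFinset.1 (Subtype.prop _)))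
    · exact Subtype.val_injective.comp (Equiv.injective _)
    · intro i j hij
      refine hC (hT (hTf.mem_toFinset.1 (Subtype.prop _)))
        (hT (hTf.mem_toFinset.1 (Subtype.prop _))) ?_
      exact fun h => hij ((Equiv.injective _) (Subtype.ext h))
  · rintro ⟨x, hxs, hinj, hx⟩
    have h1 : Metric.IsSeparated (d : ℝ≥0∞) (range x) := by
      rintro _ ⟨i, rfl⟩ _ ⟨j, rfl⟩ hij
      exact hx fun h => hij (h ▸ rfl)
    have h2 := h1.encard_le_packingNumber (A := s) (range_subset_iff.2 hxs)
    rw [← image_univ, hinj.encard_image, encard_univ] at h2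
    simpa using h2

/-- Having distances strictly above `d` is an open condition on a tuple. So `k` such points exist
exactly when σ meets each of `k` basic open sets that are disjoint and pairwise more than `d` apart,
and there are only countably many choices of these sets. -/
theorem measurable_packingNumber (d : ℝ≥0) :
    Measurable fun σ : Config n => Metric.packingNumber d σ.1 := by
  have key : ∀ k : ℕ, MeasurableSet {σ : Config n | (k : ℕ∞) ≤ Metric.packingNumber d σ.1} := by
    intro k
    set B := TopologicalSpace.countableBasis (Space n)
    have hB := TopologicalSpace.isBasis_countableBasis (Space n)
    have : {σ : Config n | (k : ℕ∞) ≤ Metric.packingNumber d σ.1} =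
        ⋃ (u : Fin k → B) (_ : Pairwise fun i j => Disjoint (u i : Set (Space n)) (u j) ∧
            ∀ a ∈ (u i : Set (Space n)), ∀ b ∈ (u j : Set (Space n)), (d : ℝ≥0∞) < edist a b),
          ⋂ i, {σ : Config n | 1 ≤ (σ.1 ∩ u i).encard} := by
      ext σ
      simp only [mem_ofPred_eq, natCast_le_packingNumber_iff, mem_iUnion, mem_iInter,
        one_le_encard_iff_nonempty, exists_prop]
      constructor
      · rintro ⟨x, hx, hinj, hd⟩
        have hnb : ∀ p : Fin k × Fin k, ∀ᶠ y in 𝓝 x, p.1 ≠ p.2 →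
            (d : ℝ≥0∞) < edist (y p.1) (y p.2) := by
          intro p
          by_cases hp : p.1 = p.2
          · simp [hp]
          · have hc : Continuous fun y : Fin k → Space n => edist (y p.1) (y p.2) := by fun_prop
            filter_upwards [hc.continuousAt.eventually (lt_mem_nhds (hd hp))] with y hy _ using hy
        have hnb' := eventually_all.2 hnb
        obtain ⟨v, hv, hvs⟩ : ∃ v : Fin k → Set (Space n), (∀ i, v i ∈ B ∧ x i ∈ v i) ∧
            univ.pi v ⊆ {y | ∀ p : Fin k × Fin k, p.1 ≠ p.2 →
              (d : ℝ≥0∞) < edist (y p.1) (y p.2)} := by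
          have hnb'' := hnb'
          rw [nhds_pi, Filter.Eventually] at hnb''
          have := (Filter.hasBasis_pi fun i => hB.nhds_hasBasis (a := x i)).mem_iff.1 hnb''
          obtain ⟨⟨I, v⟩, ⟨hI, hv⟩, hsub⟩ := this
          classical
          have hex : ∀ i, ∃ w ∈ B, x i ∈ w := fun i => by
            obtain ⟨w, hw, hxw, -⟩ := hB.exists_subset_of_mem_open (mem_univ (x i)) isOpen_univ
            exact ⟨w, hw, hxw⟩
          choose w hw hxw using hex
          refine ⟨fun i => if i ∈ I then v i else w i, fun i => ?_, ?_⟩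
          · by_cases hi : i ∈ I
            · simpa [hi] using hv i hi
            · simpa [hi] using ⟨hw i, hxw i⟩
          · refine Subset.trans ?_ hsub
            intro y hy i hi
            have := hy i trivial
            simpa [hi] using this
        have hsep : ∀ i j, i ≠ j → ∀ a ∈ v i, ∀ b ∈ v j, (d : ℝ≥0∞) < edist a b := by
          intro i j hij a ha b hb
          classical
          -- Moving only the coordinates `i` and `j` stays inside the product neighbourhood, so its
          -- pointwise property separates all of `v i` from all of `v j`.
          have hy : Function.update (Function.update x i a) j b ∈ univ.pi v := by
            intro l _
            by_cases hl : l = j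
            · subst hl; simpa using hb
            · by_cases hl' : l = i
              · subst hl'; simpa [hl] using ha
              · simpa [hl, hl'] using (hv l).2
          have := hvs hy (i, j) hij
          simpa [hij] using this
        refine ⟨fun i => ⟨v i, (hv i).1⟩, fun i j hij => ⟨?_, hsep i j hij⟩, fun i =>
          ⟨x i, hx i, (hv i).2⟩⟩
        rw [Set.disjoint_left]
        intro a ha hb
        simpa using hsep i j hij a ha a hb
      · rintro ⟨u, hu, hne⟩
        choose x hx using hne
        refine ⟨x, fun i => (hx i).1, fun i j hij => ?_, fun i j hij =>
          (hu hij).2 _ (hx i).2 _ (hx j).2⟩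
        by_contra h
        exact Set.disjoint_left.1 (hu h).1 (hx i).2 (hij ▸ (hx j).2)
    rw [this]
    have : Countable B := (TopologicalSpace.countable_countableBasis _).to_subtype
    refine MeasurableSet.iUnion fun u => MeasurableSet.iUnion fun _ => MeasurableSet.iInter
      fun i => ?_
    exact measurable_encard_inter (hB.isOpen (u i).2).measurableSet
      (MeasurableSet.of_discrete (s := Ici (1 : ℕ∞)))
  refine measurable_to_countable' fun a => ?_
  induction a using ENat.recTopCoe with
  | top =>
    have : (fun σ : Config n => Metric.packingNumber d σ.1) ⁻¹' {⊤} =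
        ⋂ k : ℕ, {σ : Config n | (k : ℕ∞) ≤ Metric.packingNumber d σ.1} := by
      ext σ
      simp only [mem_preimage, mem_singleton_iff, mem_iInter, mem_ofPred_eq]
      exact ⟨fun h k => h ▸ le_top, fun h => ENat.eq_top_iff_forall_ge.2 h⟩
    rw [this]
    exact MeasurableSet.iInter key
  | coe k =>
    have : (fun σ : Config n => Metric.packingNumber d σ.1) ⁻¹' {(k : ℕ∞)} =
        {σ : Config n | (k : ℕ∞) ≤ Metric.packingNumber d σ.1} \
          {σ : Config n | ((k + 1 : ℕ) : ℕ∞) ≤ Metric.packingNumber d σ.1} := by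
      ext σ
      change Metric.packingNumber d σ.1 = k ↔ (k : ℕ∞) ≤ Metric.packingNumber d σ.1 ∧
        ¬ ((k + 1 : ℕ) : ℕ∞) ≤ Metric.packingNumber d σ.1
      rw [not_le, Nat.cast_add, Nat.cast_one, ENat.lt_add_one_iff (ENat.natCast_ne_top k),
        and_comm, le_antisymm_iff]
    rw [this]
    exact (key k).diff (key (k + 1))

/-! ### Poisson expectations as series of integrals over tuples -/

theorem measurableSet_countEvent {V : Set (Space n)} (hV : MeasurableSet V) (m : ℕ) :
    MeasurableSet (countEvent V m) :=
  measurable_encard_inter hV (measurableSet_singleton (m : ℕ∞))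

theorem iUnion_countEvent {V : Set (Space n)} (hV : Bornology.IsBounded V) :
    ⋃ m, countEvent V m = univ := by
  refine eq_univ_of_forall fun σ => mem_iUnion.2 ?_
  obtain ⟨m, hm⟩ := ENat.ne_top_iff_exists.1 (encard_ne_top_iff.2 (σ.2 V hV))
  exact ⟨m, hm.symm⟩

theorem pairwise_disjoint_countEvent (V : Set (Space n)) :
    Pairwise fun i j => Disjoint (countEvent V i) (countEvent V j) := by
  intro i j hij
  rw [Set.disjoint_left]
  intro σ hi hj
  exact hij (by simpa using hi.symm.trans hj)

theorem map_restrict_cond {P : Measure (Config n)} (hP : IsPoissonField 1 P)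
    {V : Set (Space n)} (hV : MeasurableSet V) (hb : Bornology.IsBounded V)
    (h0 : volume V ≠ 0) (m : ℕ) :
    (cond P (countEvent V m)).map (Config.restrict V) =
      (volume V ^ m)⁻¹ • (volume.restrict (univ.pi fun _ : Fin m => V)).map Config.ofTuple := by
  ext A hA
  rw [Measure.map_apply (measurable_restrict hV) hA, hP.uniform V hV hb h0 m A hA,
    Measure.smul_apply, Measure.map_apply measurable_ofTuple hA,
    Measure.restrict_apply (measurable_ofTuple hA), smul_eq_mul, ENNReal.div_eq_inv_mul]
  congr 2
  ext x
  simp [Set.mem_pi, and_comm]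

/-- Condition on the number of points: the factor vol(V)ᵐ of the Poisson weight cancels the
normalization of the uniform law, leaving unnormalized Lebesgue integrals. -/
theorem lintegral_restrict {P : Measure (Config n)} (hP : IsPoissonField 1 P)
    {V : Set (Space n)} (hV : MeasurableSet V) (hb : Bornology.IsBounded V)
    (h0 : volume V ≠ 0) {f : Config n → ℝ≥0∞} (hf : Measurable f) :
    ∫⁻ σ, f (σ.restrict V) ∂P = ∑' m : ℕ,
      ENNReal.ofReal (Real.exp (-(volume V).toReal) / m.factorial) *
        ∫⁻ x in univ.pi fun _ : Fin m => V, f (Config.ofTuple x) := by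
  have := hP.isProbabilityMeasure
  have hfin : volume V ≠ ∞ := hb.measure_lt_top.ne
  have hpos : 0 < (volume V).toReal := ENNReal.toReal_pos h0 hfin
  rw [← setLIntegral_univ, ← iUnion_countEvent hb,
    lintegral_iUnion (measurableSet_countEvent hV) (pairwise_disjoint_countEvent V)]
  refine tsum_congr fun m => ?_
  have hc := hP.count V hV hb m
  have hc0 : P (countEvent V m) ≠ 0 := by
    rw [hc]
    simp only [one_mul, ne_eq, ENNReal.ofReal_eq_zero, not_le]
    positivity
  have h1 : P.restrict (countEvent V m) = P (countEvent V m) • cond P (countEvent V m) := by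
    rw [ProbabilityTheory.cond, smul_smul, ENNReal.mul_inv_cancel hc0 (measure_ne_top _ _), one_smul]
  rw [h1, lintegral_smul_measure, ← lintegral_map hf (measurable_restrict hV),
    map_restrict_cond hP hV hb h0, lintegral_smul_measure, lintegral_map hf measurable_ofTuple,
    smul_eq_mul, smul_eq_mul, ← mul_assoc, hc]
  congr 1
  rw [one_mul, mul_div_right_comm, ENNReal.ofReal_mul (by positivity),
    ENNReal.ofReal_pow hpos.le, ENNReal.ofReal_toReal hfin, mul_assoc,
    ENNReal.mul_inv_cancel (pow_ne_zero _ h0) (ENNReal.pow_ne_top hfin), mul_one]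

/-! ### Volumes of cubes, boxes and balls -/

/-- The half-open cube with lower corner `a` and side `l`. -/
def cube (a : Fin n → ℝ) (l : ℝ) : Set (Space n) := {x | ∀ i, a i ≤ x i ∧ x i < a i + l}

theorem volume_setOf_forall_mem (S : Fin n → Set ℝ) :
    volume {x : Space n | ∀ i, x i ∈ S i} = ∏ i, volume (S i) := by
  have h := (PiLp.volume_preserving_ofLp (Fin n)).measure_preimage_equiv
    (f := (MeasurableEquiv.toLp 2 (Fin n → ℝ)).symm) (univ.pi S)
  rw [volume_pi_pi] at h
  rw [← h]
  congr 1
  ext x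
  simp

theorem volume_cube (a : Fin n → ℝ) (l : ℝ) : volume (cube a l) = ENNReal.ofReal l ^ n := by
  have := volume_setOf_forall_mem fun i => Ico (a i) (a i + l)
  simpa [cube] using this

theorem measurableSet_cube (a : Fin n → ℝ) (l : ℝ) : MeasurableSet (cube a l) := by
  unfold cube
  measurability

theorem volume_box (N : ℝ) : volume (box n N) = ENNReal.ofReal (2 * N) ^ n := by
  have := volume_setOf_forall_mem fun _ : Fin n => Icc (-N) N
  simpa [box, abs_le, two_mul] using this

theorem measurableSet_box (N : ℝ) : MeasurableSet (box n N) := by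
  unfold box
  measurability

theorem isBounded_box (N : ℝ) : Bornology.IsBounded (box n N) := by
  have h : box n N ⊆ (WithLp.ofLp : Space n → Fin n → ℝ) ⁻¹' (Metric.closedBall 0 |N|) := by
    intro x hx
    simp only [mem_preimage, mem_closedBall_zero_iff]
    refine (pi_norm_le_iff_of_nonneg (abs_nonneg N)).2 fun i => ?_
    exact (hx i).trans (le_abs_self N)
  exact ((PiLp.antilipschitzWith_ofLp 2 (fun _ : Fin n => ℝ)).isBounded_preimage
    Metric.isBounded_closedBall).subset h

theorem isBounded_cube (a : Fin n → ℝ) (l : ℝ) : Bornology.IsBounded (cube a l) := by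
  refine (isBounded_box (n := n) (∑ i, (|a i| + |l|))).subset fun x hx i => ?_
  have h1 : |a i| + |l| ≤ ∑ i, (|a i| + |l|) :=
    Finset.single_le_sum (f := fun i => |a i| + |l|) (fun i _ => by positivity)
      (Finset.mem_univ i)
  refine le_trans ?_ h1
  have := hx i
  rw [abs_le]
  constructor
  · linarith [neg_abs_le (a i), abs_nonneg l]
  · linarith [le_abs_self (a i), le_abs_self l]

theorem abs_apply_sub_le_dist (x y : Space n) (i : Fin n) : |x i - y i| ≤ dist x y := by
  rw [EuclideanSpace.dist_eq, ← Real.sqrt_sq_eq_abs]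
  refine Real.sqrt_le_sqrt ?_
  have := Finset.single_le_sum (f := fun i => dist (x i) (y i) ^ 2) (fun i _ => by positivity)
      (Finset.mem_univ i)
  simpa [Real.dist_eq, sq_abs] using this

theorem dist_le_of_forall_abs_le (hn : 1 ≤ n) {l : ℝ} (x y : Space n)
    (h : ∀ i, |x i - y i| ≤ l) : dist x y ≤ n * l := by
  have hl : 0 ≤ l := (abs_nonneg _).trans (h ⟨0, hn⟩)
  rw [EuclideanSpace.dist_eq]
  refine Real.sqrt_le_iff.2 ⟨by positivity, ?_⟩
  calc ∑ i, dist (x i) (y i) ^ 2 ≤ ∑ _i : Fin n, l ^ 2 := by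
        refine Finset.sum_le_sum fun i _ => ?_
        rw [Real.dist_eq]
        exact pow_le_pow_left₀ (abs_nonneg _) (h i) 2
    _ = n * l ^ 2 := by simp
    _ ≤ (n * l) ^ 2 := by
        rw [mul_pow]
        gcongr
        have : (1 : ℝ) ≤ n := by exact_mod_cast hn
        nlinarith

theorem volume_closedBall (x : Space n) (r : ℝ) :
    volume (Metric.closedBall x r) = ENNReal.ofReal (ballVol n r) := by
  rw [ballVol, ENNReal.ofReal_toReal measure_closedBall_lt_top.ne,
    Measure.addHaar_closedBall_center]

theorem volume_ball (x : Space n) (r : ℝ) (hn : 1 ≤ n) :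
    volume (Metric.ball x r) = ENNReal.ofReal (ballVol n r) := by
  have : Nonempty (Fin n) := ⟨⟨0, hn⟩⟩
  rw [← volume_closedBall x, Measure.addHaar_closedBall_eq_addHaar_ball]

theorem ballVol_nonneg (r : ℝ) : 0 ≤ ballVol n r := ENNReal.toReal_nonneg

theorem ballVol_mul {r s : ℝ} (hr : 0 ≤ r) (hs : 0 ≤ s) :
    ballVol n (r * s) = r ^ n * ballVol n s := by
  rw [ballVol, Measure.addHaar_closedBall_mul _ _ hr hs, ENNReal.toReal_mul,
    ENNReal.toReal_ofReal (by positivity), finrank_euclideanSpace_fin, ballVol]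

theorem ballVol_eq {r : ℝ} (hr : 0 ≤ r) : ballVol n r = r ^ n * ballVol n 1 := by
  rw [← ballVol_mul hr zero_le_one, mul_one]

theorem ballVol_pos {r : ℝ} (hr : 0 < r) : 0 < ballVol n r :=
  ENNReal.toReal_pos (Metric.measure_closedBall_pos _ _ hr).ne' measure_closedBall_lt_top.ne

theorem ballVol_half {r : ℝ} (hr : 0 ≤ r) : ballVol n (r / 2) = 2⁻¹ ^ n * ballVol n r := by
  rw [div_eq_inv_mul, ballVol_mul (by norm_num) hr]

theorem ballVol_zero (hn : 1 ≤ n) : ballVol n 0 = 0 := by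
  rw [ballVol_eq le_rfl, zero_pow (by omega), zero_mul]

theorem ballVol_mono {r s : ℝ} (hr : 0 ≤ r) (h : r ≤ s) : ballVol n r ≤ ballVol n s := by
  rw [ballVol_eq hr, ballVol_eq (hr.trans h)]
  exact mul_le_mul_of_nonneg_right (pow_le_pow_left₀ hr h n) (ballVol_nonneg 1)

theorem ballVol_lt {r s : ℝ} (hn : 1 ≤ n) (hr : 0 ≤ r) (h : r < s) :
    ballVol n r < ballVol n s := by
  rw [ballVol_eq hr, ballVol_eq (hr.trans h.le)]
  exact mul_lt_mul_of_pos_right (pow_lt_pow_left₀ h hr (by omega)) (ballVol_pos one_pos)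

theorem exists_ballVol_eq (hn : 1 ≤ n) {t : ℝ} (ht : 0 < t) : ∃ d : ℝ, 0 < d ∧ ballVol n d = t := by
  have h1 := ballVol_pos (n := n) one_pos
  refine ⟨(t / ballVol n 1) ^ ((n : ℝ)⁻¹), by positivity, ?_⟩
  rw [ballVol_eq (by positivity), Real.rpow_inv_natCast_pow (by positivity) (by omega),
    div_mul_cancel₀ _ h1.ne']

theorem volume_biUnion_closedBall_inter_le {t : Set (Space n)} (ht : t.Finite) (r N : ℝ) :
    (volume ((⋃ x ∈ t, Metric.closedBall x r) ∩ box n N)).toReal ≤ t.ncard * ballVol n r := by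
  refine ENNReal.toReal_le_of_le_ofReal (by positivity [ballVol_nonneg (n := n) r]) ?_
  refine (measure_mono inter_subset_left).trans ?_
  have h := measure_biUnion_finset_le (μ := (volume : Measure (Space n))) ht.toFinset
    fun x => Metric.closedBall x r
  simp only [Finite.mem_toFinset, volume_closedBall, Finset.sum_const, nsmul_eq_mul] at h
  rwa [← ncard_eq_toFinset_card t ht, ← ENNReal.ofReal_natCast,
    ← ENNReal.ofReal_mul (by positivity)] at h

/-- The open balls of radius `d / 2` are disjoint and lie in the box enlarged by `d / 2`; what they
lose outside the original box is at most the volume of the shell. -/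
theorem le_volume_biUnion_closedBall_inter (hn : 1 ≤ n) {t : Set (Space n)} (ht : t.Finite)
    {d r N : ℝ} (hd : 0 < d) (hr : d / 2 ≤ r) (hN : 0 ≤ N) (htN : t ⊆ box n N)
    (hsep : t.Pairwise fun x y => d ≤ dist x y) :
    t.ncard * ballVol n (d / 2) - ((2 * N + d) ^ n - (2 * N) ^ n) ≤
      (volume ((⋃ x ∈ t, Metric.closedBall x r) ∩ box n N)).toReal := by
  set U := ⋃ x ∈ t, Metric.ball x (d / 2) with hU
  have hUvol : volume U = ENNReal.ofReal (t.ncard * ballVol n (d / 2)) := by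
    have h := measure_biUnion_finset (μ := (volume : Measure (Space n))) (s := ht.toFinset)
      (f := fun x => Metric.ball x (d / 2)) (by
        intro x hx y hy hxy
        refine Metric.ball_disjoint_ball ?_
        have := hsep (ht.mem_toFinset.1 hx) (ht.mem_toFinset.1 hy) hxy
        linarith) (fun _ _ => measurableSet_ball)
    simp only [Finite.mem_toFinset, volume_ball _ _ hn, Finset.sum_const, nsmul_eq_mul] at h
    rw [hU, h, ← ncard_eq_toFinset_card t ht, ← ENNReal.ofReal_natCast,
      ← ENNReal.ofReal_mul (by positivity)]
  have hUbox : U ⊆ box n (N + d / 2) := by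
    intro y hy i
    obtain ⟨x, hx, hy⟩ := mem_iUnion₂.1 hy
    have h1 := (abs_apply_sub_le_dist y x i).trans (Metric.mem_ball.1 hy).le
    have h2 := htN hx i
    rw [abs_le] at h1 h2 ⊢
    constructor <;> linarith
  have hbox : box n N ⊆ box n (N + d / 2) := fun x hx i => (hx i).trans (by linarith)
  have hsub : U ⊆ ((⋃ x ∈ t, Metric.closedBall x r) ∩ box n N) ∪
      (box n (N + d / 2) \ box n N) := by
    intro y hy
    by_cases hb : y ∈ box n N
    · refine Or.inl ⟨?_, hb⟩
      obtain ⟨x, hx, hy⟩ := mem_iUnion₂.1 hy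
      exact mem_iUnion₂.2 ⟨x, hx, Metric.closedBall_subset_closedBall hr
        (Metric.ball_subset_closedBall hy)⟩
    · exact Or.inr ⟨hUbox hy, hb⟩
  have hle := (measure_mono (μ := volume) hsub).trans (measure_union_le _ _)
  have hfin : volume ((⋃ x ∈ t, Metric.closedBall x r) ∩ box n N) ≠ ∞ :=
    (measure_mono inter_subset_right).trans_lt
      (isBounded_box N).measure_lt_top |>.ne
  rw [hUvol, measure_sdiff hbox (measurableSet_box N).nullMeasurableSet
    (isBounded_box N).measure_lt_top.ne, volume_box, volume_box,
    ← ENNReal.ofReal_pow (by positivity), ← ENNReal.ofReal_pow (by positivity),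
    ← ENNReal.ofReal_sub _ (by positivity), ← ENNReal.ofReal_toReal hfin,
    ← ENNReal.ofReal_add (by positivity) (sub_nonneg.2 (by gcongr; linarith)),
    ENNReal.ofReal_le_ofReal_iff (add_nonneg (by positivity)
      (sub_nonneg.2 (by gcongr; linarith)))] at hle
  have : 2 * (N + d / 2) = 2 * N + d := by ring
  rw [this] at hle
  linarith

/-! ### Deterministic inequalities for packing numbers -/

section Packing

variable {X : Type*} [PseudoEMetricSpace X]

theorem packingNumber_mono_set {d : ℝ≥0} {A B : Set X} (h : A ⊆ B) :
    Metric.packingNumber d A ≤ Metric.packingNumber d B :=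
  iSup_le fun _ => iSup₂_le fun hC hC' => hC'.encard_le_packingNumber (hC.trans h)

theorem packingNumber_union_le (d : ℝ≥0) (A B : Set X) :
    Metric.packingNumber d (A ∪ B) ≤ Metric.packingNumber d A + Metric.packingNumber d B := by
  refine iSup_le fun C => iSup₂_le fun hC hC' => ?_
  calc C.encard ≤ ((C ∩ A) ∪ (C ∩ B)).encard := by
        rw [← inter_union_distrib_left, inter_eq_left.2 hC]
    _ ≤ (C ∩ A).encard + (C ∩ B).encard := encard_union_le _ _
    _ ≤ _ := add_le_add
        ((hC'.subset inter_subset_left).encard_le_packingNumber inter_subset_right)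
        ((hC'.subset inter_subset_left).encard_le_packingNumber inter_subset_right)

theorem packingNumber_biUnion_le {ι : Type*} (d : ℝ≥0) (s : Finset ι) (A : ι → Set X) :
    Metric.packingNumber d (⋃ i ∈ s, A i) ≤ ∑ i ∈ s, Metric.packingNumber d (A i) := by
  classical
  induction s using Finset.induction_on with
  | empty => simp
  | insert i s hi ih =>
    rw [Finset.set_biUnion_insert, Finset.sum_insert hi]
    exact (packingNumber_union_le d _ _).trans (by gcongr)

theorem add_le_packingNumber_union {d : ℝ≥0} {A B : Set X}
    (h : ∀ a ∈ A, ∀ b ∈ B, (d : ℝ≥0∞) < edist a b) :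
    Metric.packingNumber d A + Metric.packingNumber d B ≤ Metric.packingNumber d (A ∪ B) := by
  by_cases hA : Metric.packingNumber d A = ⊤
  · rw [top_le_iff.1 (hA.ge.trans (packingNumber_mono_set subset_union_left))]
    exact le_top
  by_cases hB : Metric.packingNumber d B = ⊤
  · rw [top_le_iff.1 (hB.ge.trans (packingNumber_mono_set subset_union_right))]
    exact le_top
  obtain ⟨C, hCA, -, hC, hCe⟩ := Metric.exists_set_encard_eq_packingNumber hA
  obtain ⟨D, hDB, -, hD, hDe⟩ := Metric.exists_set_encard_eq_packingNumber hB
  have hdisj : Disjoint C D := by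
    rw [Set.disjoint_left]
    intro x hx hx'
    simpa using h x (hCA hx) x (hDB hx')
  rw [← hCe, ← hDe, ← encard_union_eq hdisj]
  refine Metric.IsSeparated.encard_le_packingNumber (union_subset_union hCA hDB) ?_
  rintro x (hx | hx) y (hy | hy) hxy
  · exact hC hx hy hxy
  · exact h x (hCA hx) y (hDB hy)
  · rw [edist_comm]
    exact h y (hCA hy) x (hDB hx)
  · exact hD hx hy hxy

theorem sum_le_packingNumber_biUnion {ι : Type*} {d : ℝ≥0} (s : Finset ι) (A : ι → Set X)
    (h : ∀ i ∈ s, ∀ j ∈ s, i ≠ j → ∀ a ∈ A i, ∀ b ∈ A j, (d : ℝ≥0∞) < edist a b) :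
    ∑ i ∈ s, Metric.packingNumber d (A i) ≤ Metric.packingNumber d (⋃ i ∈ s, A i) := by
  classical
  induction s using Finset.induction_on with
  | empty => simp
  | insert i s hi ih =>
    rw [Finset.set_biUnion_insert, Finset.sum_insert hi]
    refine le_trans (add_le_add_right (ih fun j hj k hk => h j (Finset.mem_insert_of_mem hj) k
      (Finset.mem_insert_of_mem hk)) _) (add_le_packingNumber_union ?_)
    intro a ha b hb
    obtain ⟨j, hj, hb⟩ := mem_iUnion₂.1 hb
    exact h i (Finset.mem_insert_self i s) j (Finset.mem_insert_of_mem hj)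
      (fun e => hi (e ▸ hj)) a ha b hb

theorem packingNumber_le_image {Y : Type*} [PseudoEMetricSpace Y] {f : X → Y} (hf : Isometry f)
    (hi : Function.Injective f) (d : ℝ≥0) (A : Set X) :
    Metric.packingNumber d A ≤ Metric.packingNumber d (f '' A) := by
  refine iSup_le fun C => iSup₂_le fun hC hC' => ?_
  rw [← hi.encard_image C]
  refine Metric.IsSeparated.encard_le_packingNumber (image_mono hC) ?_
  rintro _ ⟨a, ha, rfl⟩ _ ⟨b, hb, rfl⟩ hab
  rw [hf.edist_eq]
  exact hC' ha hb fun e => hab (e ▸ rfl)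

theorem packingNumber_image {Y : Type*} [PseudoEMetricSpace Y] (f : X ≃ᵢ Y) (d : ℝ≥0)
    (A : Set X) : Metric.packingNumber d (f '' A) = Metric.packingNumber d A := by
  refine le_antisymm ?_ (packingNumber_le_image f.isometry f.injective d A)
  have := packingNumber_le_image f.symm.isometry f.symm.injective d (f '' A)
  rwa [← image_comp, f.symm_comp_self, image_id] at this

/-- Each selected point is compared with all earlier points, selected or not. This is wasteful as a
packing, but makes the selection probability of an index explicit. -/
theorem card_firstInBall_le {m : ℕ} (d : ℝ≥0) (x : Fin m → X) (T : Finset (Fin m))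
    (hT : ∀ i ∈ T, ∀ j < i, (d : ℝ≥0∞) < edist (x j) (x i)) :
    (T.card : ℕ∞) ≤ Metric.packingNumber d (range x) := by
  have key : ∀ i ∈ T, ∀ j ∈ T, i ≠ j → (d : ℝ≥0∞) < edist (x i) (x j) := by
    intro i hi j hj hij
    rcases lt_or_gt_of_ne hij with h | h
    · exact hT j hj i h
    · rw [edist_comm]
      exact hT i hi j h
  have hinj : InjOn x (T : Set (Fin m)) := by
    intro i hi j hj hij
    by_contra hne
    have := key i hi j hj hne
    rw [hij, edist_self] at this
    exact absurd this (by simp)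
  have h2 := hinj.encard_image
  rw [encard_coe_eq_coe_finsetCard] at h2
  rw [← h2]
  refine Metric.IsSeparated.encard_le_packingNumber (image_subset_range _ _) ?_
  rintro _ ⟨i, hi, rfl⟩ _ ⟨j, hj, rfl⟩ hij
  exact key i hi j hj fun e => hij (e ▸ rfl)

/-- The points with indices `i < j` have a distance in `(d', d]`, and all others are at a distance
larger than `d` from both. -/
def IsIsolatedPair (d' d : ℝ≥0) {ι : Type*} [LT ι] (x : ι → X) (i j : ι) : Prop :=
  i < j ∧ (d' : ℝ≥0∞) < edist (x i) (x j) ∧ edist (x i) (x j) ≤ d ∧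
    ∀ k, k ≠ i → k ≠ j → (d : ℝ≥0∞) < edist (x k) (x i) ∧ (d : ℝ≥0∞) < edist (x k) (x j)

/-- A maximal `d`-packing misses a point of every isolated pair, since the two are within `d` of
each other. Adding one missed point per pair keeps all distances above `d'`. -/
theorem packingNumber_add_card_isolatedPair_le {m : ℕ} {d' d : ℝ≥0} (hd : d' ≤ d)
    (x : Fin m → X) (T : Finset (Fin m × Fin m))
    (hT : ∀ p ∈ T, IsIsolatedPair d' d x p.1 p.2) :
    Metric.packingNumber d (range x) + T.card ≤ Metric.packingNumber d' (range x) := by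
  classical
  have hfin : Metric.packingNumber d (range x) ≠ ⊤ :=
    ((Metric.packingNumber_le_encard_self _).trans_lt (finite_range x).encard_lt_top).ne
  obtain ⟨S, hS, -, hSsep, hSe⟩ := Metric.exists_set_encard_eq_packingNumber hfin
  have hg : ∀ p, ∃ i, p ∈ T → (i = p.1 ∨ i = p.2) ∧ x i ∉ S := by
    intro p
    by_cases hp : p ∈ T
    swap
    · exact ⟨p.1, fun h => absurd h hp⟩
    by_contra! hcon
    have h := fun i => (hcon i).2
    obtain ⟨h1, h2, h3, -⟩ := hT p hp
    have := hSsep (h p.1 (Or.inl rfl)) (h p.2 (Or.inr rfl)) (by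
      intro e
      rw [e, edist_self] at h2
      exact absurd h2 (by simp))
    exact absurd h3 (not_le.2 this)
  choose g hg' using hg
  have hg := fun p hp => (hg' p hp).1
  have hgS := fun p hp => (hg' p hp).2
  -- Distinct isolated pairs share no index: the partner of a shared index in one pair would be
  -- foreign to the other, hence farther than `d` from it.
  have hfar : ∀ p ∈ T, ∀ q ∈ T, p ≠ q → (d : ℝ≥0∞) < edist (x (g p)) (x (g q)) := by
    intro p hp q hq hpq
    obtain ⟨p1, p2, p3, p4⟩ := hT p hp
    obtain ⟨q1, q2, q3, q4⟩ := hT q hq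
    have hne : ∀ i, (i = q.1 ∨ i = q.2) → i ≠ p.1 ∧ i ≠ p.2 := by
      intro i hi
      by_contra hcon
      have hi' : i = p.1 ∨ i = p.2 := by tauto
      have hlt : ¬ (d : ℝ≥0∞) < edist (x q.1) (x q.2) := not_lt.2 q3
      have hlt' : ¬ (d : ℝ≥0∞) < edist (x q.2) (x q.1) := by rw [edist_comm]; exact hlt
      rcases hi with rfl | rfl
      · by_cases h1 : q.2 = p.1
        · rcases hi' with h | h
          · exact absurd (h.trans h1.symm) q1.ne
          · rw [h, h1] at q1
            exact absurd q1 (not_lt.2 p1.le)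
        · by_cases h2 : q.2 = p.2
          · rcases hi' with h | h
            · exact hpq (Prod.ext h.symm h2.symm)
            · exact absurd (h.trans h2.symm) q1.ne
          · have := p4 q.2 h1 h2
            rcases hi' with h | h
            · exact hlt' (h ▸ this.1)
            · exact hlt' (h ▸ this.2)
      · by_cases h1 : q.1 = p.1
        · rcases hi' with h | h
          · exact absurd (h1.trans h.symm) q1.ne
          · exact hpq (Prod.ext h1.symm h.symm)
        · by_cases h2 : q.1 = p.2
          · rcases hi' with h | h
            · rw [h, h2] at q1
              exact absurd q1 (not_lt.2 p1.le)
            · exact absurd (h2.trans h.symm) q1.ne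
          · have := p4 q.1 h1 h2
            rcases hi' with h | h
            · exact hlt (h ▸ this.1)
            · exact hlt (h ▸ this.2)
    have := hne (g q) (hg q hq)
    have h4 := p4 (g q) this.1 this.2
    rw [edist_comm]
    rcases hg p hp with h | h
    · rw [h]; exact h4.1
    · rw [h]; exact h4.2
  have hmixed : ∀ s ∈ S, ∀ p ∈ T, (d' : ℝ≥0∞) < edist s (x (g p)) := by
    intro s hs p hp
    obtain ⟨p1, p2, p3, p4⟩ := hT p hp
    obtain ⟨k, rfl⟩ := hS hs
    have hk : k ≠ g p := fun e => hgS p hp (e ▸ hs)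
    have hd' : (d' : ℝ≥0∞) ≤ d := ENNReal.coe_le_coe.2 hd
    rcases hg p hp with h | h
    · rw [h] at hk ⊢
      by_cases h2 : k = p.2
      · rw [h2, edist_comm]; exact p2
      · exact hd'.trans_lt (p4 k hk h2).1
    · rw [h] at hk ⊢
      by_cases h2 : k = p.1
      · rw [h2]; exact p2
      · exact hd'.trans_lt (p4 k h2 hk).2
  have hinj : InjOn (fun p => x (g p)) (T : Set (Fin m × Fin m)) := by
    intro p hp q hq hpq
    by_contra hne
    have h := hfar p hp q hq hne
    rw [show x (g p) = x (g q) from hpq, edist_self] at h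
    exact absurd h (by simp)
  have hdisj : Disjoint S ((fun p => x (g p)) '' (T : Set (Fin m × Fin m))) := by
    rw [Set.disjoint_right]
    rintro _ ⟨p, hp, rfl⟩
    exact hgS p hp
  rw [← hSe, ← encard_coe_eq_coe_finsetCard, ← hinj.encard_image, ← encard_union_eq hdisj]
  refine Metric.IsSeparated.encard_le_packingNumber (union_subset hS ?_) ?_
  · rintro _ ⟨p, -, rfl⟩
    exact mem_range_self _
  · have hd' : (d' : ℝ≥0∞) ≤ d := ENNReal.coe_le_coe.2 hd
    rintro a (ha | ⟨p, hp, rfl⟩) b (hb | ⟨q, hq, rfl⟩) hab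
    · exact hd'.trans_lt (hSsep ha hb hab)
    · exact hmixed a ha q hq
    · rw [edist_comm]
      exact hmixed b hb p hp
    · exact hd'.trans_lt (hfar p hp q hq fun e => hab (e ▸ rfl))

end Packing

/-! ### Volumes of events for tuples -/

/-- Fubini in the coordinate `i`; this is how the distinguished points of a tuple are fixed one at a
time. -/
theorem mul_le_volume_of_le_section {E : Type*} [MeasureSpace E] [SigmaFinite (volume : Measure E)]
    {M : ℕ} (i : Fin (M + 1)) {S : Set (Fin (M + 1) → E)} (hS : MeasurableSet S) {V : Set E}
    (hV : MeasurableSet V) {c : ℝ≥0∞}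
    (h : ∀ a ∈ V, c ≤ volume {y : Fin M → E | (i.insertNth a y : Fin (M + 1) → E) ∈ S}) :
    volume V * c ≤ volume S := by
  have hp := (volume_preserving_piFinSuccAbove (fun _ : Fin (M + 1) => E) i).symm
  rw [← hp.measure_preimage hS.nullMeasurableSet, Measure.volume_eq_prod,
    Measure.prod_apply (hp.measurable hS), mul_comm, ← setLIntegral_const]
  refine le_trans (setLIntegral_mono' hV fun a ha => h a ha) ?_
  exact setLIntegral_le_lintegral _ _

theorem measurableSet_firstInBall (d : ℝ≥0) {V : Set (Space n)} (hV : MeasurableSet V) {m : ℕ}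
    (i : Fin m) : MeasurableSet {x : Fin m → Space n |
      (∀ k, x k ∈ V) ∧ ∀ j < i, (d : ℝ≥0∞) < edist (x j) (x i)} := by
  have h1 : MeasurableSet {x : Fin m → Space n | ∀ k, x k ∈ V} := by
    rw [ofPred_forall]
    exact MeasurableSet.iInter fun k => measurable_pi_apply k hV
  have h2 : MeasurableSet {x : Fin m → Space n |
      ∀ j < i, (d : ℝ≥0∞) < edist (x j) (x i)} := by
    simp only [ofPred_forall]
    exact MeasurableSet.iInter fun j => MeasurableSet.iInter fun _ =>
      measurableSet_lt measurable_const
        ((measurable_pi_apply j).edist (measurable_pi_apply i))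
  exact h1.inter h2

theorem measurableSet_isolatedPair {d' d : ℝ≥0} {V : Set (Space n)} (hV : MeasurableSet V) {m : ℕ}
    (i j : Fin m) : MeasurableSet {x : Fin m → Space n |
      (∀ k, x k ∈ V) ∧ IsIsolatedPair d' d x i j} := by
  have hme : ∀ k l : Fin m, Measurable fun x : Fin m → Space n =>
      edist (x k) (x l) := fun k l => (measurable_pi_apply k).edist (measurable_pi_apply l)
  have h1 : MeasurableSet {x : Fin m → Space n | ∀ k, x k ∈ V} := by
    rw [ofPred_forall]
    exact MeasurableSet.iInter fun k => measurable_pi_apply k hV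
  refine h1.inter (MeasurableSet.const _ |>.inter ((measurableSet_lt measurable_const
    (hme i j)).inter ((measurableSet_le (hme i j) measurable_const).inter ?_)))
  change MeasurableSet {x : Fin m → Space n | ∀ k, k ≠ i → k ≠ j →
    (d : ℝ≥0∞) < edist (x k) (x i) ∧ (d : ℝ≥0∞) < edist (x k) (x j)}
  simp only [ofPred_forall]
  exact MeasurableSet.iInter fun k => MeasurableSet.iInter fun _ => MeasurableSet.iInter
    fun _ => (measurableSet_lt measurable_const (hme k i)).inter
      (measurableSet_lt measurable_const (hme k j))

/-- With the point of index `i` fixed, the `i` earlier points must avoid one ball and the `M - i`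
later ones are free. -/
theorem le_volume_firstInBall (d : ℝ≥0) {V : Set (Space n)} (hV : MeasurableSet V) {M : ℕ}
    (i : Fin (M + 1)) :
    volume V * ((volume V - ENNReal.ofReal (ballVol n d)) ^ (i : ℕ) * volume V ^ (M - i)) ≤
      volume {x : Fin (M + 1) → Space n |
        (∀ k, x k ∈ V) ∧ ∀ j < i, (d : ℝ≥0∞) < edist (x j) (x i)} := by
  refine mul_le_volume_of_le_section i (measurableSet_firstInBall d hV i) hV fun a ha => ?_
  have hsub : (univ.pi fun j : Fin M => if (j : ℕ) < i then V \ Metric.closedBall a d else V) ⊆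
      {y : Fin M → Space n | (i.insertNth a y : Fin (M + 1) → Space n) ∈
        {x : Fin (M + 1) → Space n |
          (∀ k, x k ∈ V) ∧ ∀ j < i, (d : ℝ≥0∞) < edist (x j) (x i)}} := by
    intro y hy
    have hyV : ∀ j, y j ∈ V := fun j => by
      have := hy j trivial
      simp only at this
      split_ifs at this
      · exact this.1
      · exact this
    refine ⟨fun k => ?_, fun j hj => ?_⟩
    · rcases Fin.eq_self_or_eq_succAbove i k with rfl | ⟨l, rfl⟩
      · simpa using ha
      · simpa using hyV l
    · rcases Fin.eq_self_or_eq_succAbove i j with rfl | ⟨l, rfl⟩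
      · exact absurd hj (lt_irrefl _)
      · have hl : (l : ℕ) < i := by
          have := Fin.succAbove_lt_iff_castSucc_lt i l |>.1 hj
          exact this
        have := hy l trivial
        simp only [hl, if_true] at this
        have h2 := this.2
        rw [Metric.mem_closedBall, not_le] at h2
        simp only [Fin.insertNth_apply_succAbove, Fin.insertNth_apply_same]
        rw [edist_nndist]
        exact_mod_cast h2
  refine le_trans ?_ (measure_mono hsub)
  rw [volume_pi_pi]
  have hi : (i : ℕ) ≤ M := Nat.lt_succ_iff.1 i.2
  have hcard : (Finset.univ.filter fun j : Fin M => (j : ℕ) < i).card = i := by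
    simp [Fin.card_filter_val_lt, hi]
  have hcard' : (Finset.univ.filter fun j : Fin M => ¬ (j : ℕ) < i).card = M - i := by
    have := Finset.card_filter_add_card_filter_not (s := (Finset.univ : Finset (Fin M)))
      (fun j : Fin M => (j : ℕ) < i)
    rw [hcard, Finset.card_univ, Fintype.card_fin] at this
    omega
  simp only [apply_ite, Finset.prod_ite, Finset.prod_const, hcard, hcard']
  gcongr
  rw [← volume_closedBall a]
  exact le_measure_sdiff

/-- Put the first point in `W` and its partner in the annulus around it, which `hWV` keeps inside
`V`. Each of the other `M` points then avoids two balls of radius `d`. -/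
theorem le_volume_isolatedPair {d' d : ℝ≥0} {V W : Set (Space n)} (hV : MeasurableSet V)
    (hW : MeasurableSet W) (hWV : ∀ a ∈ W, Metric.closedBall a d ⊆ V) {M : ℕ}
    (i j : Fin (M + 2)) (hij : i < j) :
    volume W * (ENNReal.ofReal (ballVol n d - ballVol n d') *
        (volume V - ENNReal.ofReal (2 * ballVol n d)) ^ M) ≤
      volume {x : Fin (M + 2) → Space n | (∀ k, x k ∈ V) ∧ IsIsolatedPair d' d x i j} := by
  have hS := measurableSet_isolatedPair (d' := d') (d := d) hV i j
  obtain ⟨j', rfl⟩ := Fin.exists_succAbove_eq hij.ne'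
  refine mul_le_volume_of_le_section i hS hW fun a ha => ?_
  have hann : volume (Metric.closedBall a d \ Metric.closedBall a d') ≥
      ENNReal.ofReal (ballVol n d - ballVol n d') := by
    rw [ENNReal.ofReal_sub _ (ballVol_nonneg _), ← volume_closedBall a, ← volume_closedBall a]
    exact le_measure_sdiff
  refine le_trans (mul_le_mul_left hann _) ?_
  refine mul_le_volume_of_le_section j' ?_
    (measurableSet_closedBall.diff measurableSet_closedBall) fun b hb => ?_
  · have : Measurable fun y : Fin (M + 1) → Space n =>
        (i.insertNth a y : Fin (M + 2) → Space n) := by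
      refine measurable_pi_iff.2 fun k => ?_
      rcases Fin.eq_self_or_eq_succAbove i k with rfl | ⟨l, rfl⟩
      · simp
      · simpa using measurable_pi_apply l
    exact this hS
  have hsub : (univ.pi fun _ : Fin M => V \ (Metric.closedBall a d ∪ Metric.closedBall b d)) ⊆
      {w : Fin M → Space n | (j'.insertNth b w : Fin (M + 1) → Space n) ∈
        {y : Fin (M + 1) → Space n | (i.insertNth a y : Fin (M + 2) → Space n) ∈
          {x : Fin (M + 2) → Space n |
            (∀ k, x k ∈ V) ∧ IsIsolatedPair d' d x i (i.succAbove j')}}} := by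
    intro w hw
    have hab : edist a b ≤ d ∧ (d' : ℝ≥0∞) < edist a b := by
      obtain ⟨h1, h2⟩ := hb
      rw [Metric.mem_closedBall, dist_comm] at h1 h2
      rw [edist_nndist]
      exact ⟨by exact_mod_cast h1, by exact_mod_cast not_le.1 h2⟩
    have hwk : ∀ l, w l ∈ V ∧ (d : ℝ≥0∞) < edist (w l) a ∧ (d : ℝ≥0∞) < edist (w l) b := by
      intro l
      obtain ⟨h1, h2⟩ := hw l trivial
      rw [mem_union, Metric.mem_closedBall, Metric.mem_closedBall, not_or, not_le, not_le] at h2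
      rw [edist_nndist, edist_nndist]
      exact ⟨h1, by exact_mod_cast h2.1, by exact_mod_cast h2.2⟩
    refine ⟨fun k => ?_, hij, ?_, ?_, fun k hki hkj => ?_⟩
    · rcases Fin.eq_self_or_eq_succAbove i k with rfl | ⟨l, rfl⟩
      · simpa using hWV a ha (Metric.mem_closedBall_self d.2)
      · rcases Fin.eq_self_or_eq_succAbove j' l with rfl | ⟨l, rfl⟩
        · simpa using hWV a ha hb.1
        · simpa using (hwk l).1
    · simpa using hab.2
    · simpa using hab.1
    · rcases Fin.eq_self_or_eq_succAbove i k with rfl | ⟨l, rfl⟩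
      · exact absurd rfl hki
      · rcases Fin.eq_self_or_eq_succAbove j' l with rfl | ⟨l, rfl⟩
        · exact absurd rfl hkj
        · simpa using (hwk l).2
  refine le_trans ?_ (measure_mono hsub)
  rw [volume_pi_pi, Finset.prod_const, Finset.card_univ, Fintype.card_fin]
  gcongr
  refine le_trans ?_ le_measure_sdiff
  gcongr
  refine (measure_union_le _ _).trans ?_
  rw [volume_closedBall, volume_closedBall, ← ENNReal.ofReal_add (ballVol_nonneg _)
    (ballVol_nonneg _), two_mul]

/-! ### Moments and the mean packing number -/

theorem lintegral_encard {P : Measure (Config n)} (hP : IsPoissonField 1 P)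
    {V : Set (Space n)} (hV : MeasurableSet V) (hb : Bornology.IsBounded V) (f : ℕ∞ → ℝ≥0∞) :
    ∫⁻ σ, f (σ.1 ∩ V).encard ∂P = ∑' m : ℕ, ENNReal.ofReal
      (Real.exp (-(volume V).toReal) * (volume V).toReal ^ m / m.factorial) * f m := by
  rw [← setLIntegral_univ, ← iUnion_countEvent hb,
    lintegral_iUnion (measurableSet_countEvent hV) (pairwise_disjoint_countEvent V)]
  refine tsum_congr fun m => ?_
  have h := hP.count V hV hb m
  simp only [one_mul] at h
  rw [← h, mul_comm, ← setLIntegral_const]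
  refine setLIntegral_congr_fun (measurableSet_countEvent hV m) fun σ hσ => ?_
  rw [show (σ.1 ∩ V).encard = m from hσ]

theorem lintegral_encard_eq {P : Measure (Config n)} (hP : IsPoissonField 1 P)
    {V : Set (Space n)} (hV : MeasurableSet V) (hb : Bornology.IsBounded V) :
    ∫⁻ σ, ((σ.1 ∩ V).encard : ℝ≥0∞) ∂P = volume V := by
  rw [lintegral_encard hP hV hb fun k => (k : ℝ≥0∞)]
  set w := (volume V).toReal with hw
  have hw0 : 0 ≤ w := ENNReal.toReal_nonneg
  have h1 : ∀ m : ℕ, ENNReal.ofReal (Real.exp (-w) * w ^ (m + 1) / (m + 1).factorial) *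
      (((m + 1 : ℕ) : ℕ∞) : ℝ≥0∞) =
      ENNReal.ofReal (Real.exp (-w) * w * (w ^ m / m.factorial)) := by
    intro m
    rw [ENat.toENNReal_coe, ← ENNReal.ofReal_natCast, ← ENNReal.ofReal_mul (by positivity)]
    congr 1
    rw [Nat.factorial_succ]
    push_cast
    field_simp
    ring
  rw [tsum_eq_zero_add' ENNReal.summable, tsum_congr h1]
  have h2 := (NormedSpace.expSeries_div_hasSum_exp (𝔸 := ℝ) w).mul_left (Real.exp (-w) * w)
  rw [← Real.exp_eq_exp_ℝ] at h2
  rw [← ENNReal.ofReal_tsum_of_nonneg (fun m => by positivity) h2.summable, h2.tsum_eq]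
  have h3 : Real.exp (-w) * w * Real.exp w = w := by
    rw [mul_right_comm, ← Real.exp_add, neg_add_cancel, Real.exp_zero, one_mul]
  rw [h3, hw, ENNReal.ofReal_toReal hb.measure_lt_top.ne]
  simp

/-- Only some bound depending on the volume alone is needed for the strong law, so m² ≤ 4ᵐ is used
and the exponential series is summed at 4w. -/
theorem lintegral_encard_sq_le {P : Measure (Config n)} (hP : IsPoissonField 1 P)
    {V : Set (Space n)} (hV : MeasurableSet V) (hb : Bornology.IsBounded V) :
    ∫⁻ σ, ((σ.1 ∩ V).encard : ℝ≥0∞) ^ 2 ∂P ≤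
      ENNReal.ofReal (Real.exp (3 * (volume V).toReal)) := by
  rw [lintegral_encard hP hV hb fun k => (k : ℝ≥0∞) ^ 2]
  set w := (volume V).toReal with hw
  have hw0 : 0 ≤ w := ENNReal.toReal_nonneg
  have h1 : ∀ m : ℕ, ENNReal.ofReal (Real.exp (-w) * w ^ m / m.factorial) *
      ((m : ℕ∞) : ℝ≥0∞) ^ 2 ≤
      ENNReal.ofReal (Real.exp (-w) * ((4 * w) ^ m / m.factorial)) := by
    intro m
    rw [ENat.toENNReal_coe, ← ENNReal.ofReal_natCast, ← ENNReal.ofReal_pow (by positivity),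
      ← ENNReal.ofReal_mul (by positivity)]
    refine ENNReal.ofReal_le_ofReal ?_
    have h4 : (m : ℝ) ^ 2 ≤ 4 ^ m := by
      have : (m : ℝ) ≤ 2 ^ m := by exact_mod_cast Nat.lt_two_pow_self.le
      calc (m : ℝ) ^ 2 ≤ (2 ^ m) ^ 2 := pow_le_pow_left₀ (by positivity) this 2
        _ = 4 ^ m := by rw [← pow_mul, mul_comm, pow_mul]; norm_num
    calc Real.exp (-w) * w ^ m / m.factorial * (m : ℝ) ^ 2
        ≤ Real.exp (-w) * w ^ m / m.factorial * 4 ^ m := by gcongr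
      _ = _ := by rw [mul_pow]; ring
  refine (ENNReal.tsum_le_tsum h1).trans ?_
  have h2 := (NormedSpace.expSeries_div_hasSum_exp (𝔸 := ℝ) (4 * w)).mul_left (Real.exp (-w))
  rw [← Real.exp_eq_exp_ℝ] at h2
  rw [← ENNReal.ofReal_tsum_of_nonneg (fun m => by positivity) h2.summable, h2.tsum_eq,
    ← Real.exp_add]
  refine ENNReal.ofReal_le_ofReal (Real.exp_le_exp.2 ?_)
  linarith

/-- The mean packing number of the part of a random configuration in `V`. -/
noncomputable def meanPacking (P : Measure (Config n)) (d : ℝ≥0) (V : Set (Space n)) : ℝ≥0∞ :=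
  ∫⁻ σ, (Metric.packingNumber d (σ.1 ∩ V) : ℝ≥0∞) ∂P

theorem measurable_toENNReal_packingNumber (d : ℝ≥0) :
    Measurable fun σ : Config n => (Metric.packingNumber d σ.1 : ℝ≥0∞) :=
  (measurable_of_countable (fun k : ℕ∞ => (k : ℝ≥0∞))).comp (measurable_packingNumber d)

theorem measurable_packingNumber_inter (d : ℝ≥0) {V : Set (Space n)} (hV : MeasurableSet V) :
    Measurable fun σ : Config n => (Metric.packingNumber d (σ.1 ∩ V) : ℝ≥0∞) :=
  Measurable.comp (f := Config.restrict V) (measurable_toENNReal_packingNumber d)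
    (measurable_restrict hV)

theorem measurable_packingNumber_range (d : ℝ≥0) (m : ℕ) :
    Measurable fun x : Fin m → Space n => (Metric.packingNumber d (range x) : ℝ≥0∞) :=
  Measurable.comp (f := Config.ofTuple) (measurable_toENNReal_packingNumber d) measurable_ofTuple

theorem meanPacking_eq_tsum {P : Measure (Config n)} (hP : IsPoissonField 1 P)
    {V : Set (Space n)} (hV : MeasurableSet V) (hb : Bornology.IsBounded V)
    (h0 : volume V ≠ 0) (d : ℝ≥0) :
    meanPacking P d V = ∑' m : ℕ,
      ENNReal.ofReal (Real.exp (-(volume V).toReal) / m.factorial) *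
        ∫⁻ x in univ.pi fun _ : Fin m => V, (Metric.packingNumber d (range x) : ℝ≥0∞) :=
  lintegral_restrict hP hV hb h0 (measurable_toENNReal_packingNumber d)

theorem meanPacking_zero {P : Measure (Config n)} (hP : IsPoissonField 1 P)
    {V : Set (Space n)} (hV : MeasurableSet V) (hb : Bornology.IsBounded V) :
    meanPacking P 0 V = volume V := by
  simp only [meanPacking, Metric.packingNumber_zero]
  exact lintegral_encard_eq hP hV hb

theorem meanPacking_le_add {P : Measure (Config n)} (hP : IsPoissonField 1 P) (d : ℝ≥0)
    {V W : Set (Space n)} (hV : MeasurableSet V) (hb : Bornology.IsBounded V)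
    (hW : MeasurableSet W) (hWV : W ⊆ V) :
    meanPacking P d V ≤ meanPacking P d W + volume (V \ W) := by
  rw [← lintegral_encard_eq hP (hV.diff hW) (hb.subset sdiff_subset), meanPacking, meanPacking,
    ← lintegral_add_left (measurable_packingNumber_inter d hW)]
  refine lintegral_mono fun σ => ?_
  simp only
  rw [← ENat.toENNReal_add, ENat.toENNReal_le]
  calc Metric.packingNumber d (σ.1 ∩ V)
      = Metric.packingNumber d ((σ.1 ∩ W) ∪ (σ.1 ∩ (V \ W))) := by
        rw [← inter_union_distrib_left, union_sdiff_cancel hWV]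
    _ ≤ _ := (packingNumber_union_le d _ _).trans
        (add_le_add_right (Metric.packingNumber_le_encard_self _) _)

theorem meanPacking_le_one {P : Measure (Config n)} [IsProbabilityMeasure P] {d : ℝ≥0}
    {V : Set (Space n)} (h : ∀ x ∈ V, ∀ y ∈ V, dist x y ≤ d) : meanPacking P d V ≤ 1 := by
  have key : ∀ σ : Config n, (Metric.packingNumber d (σ.1 ∩ V) : ℝ≥0∞) ≤ 1 := by
    intro σ
    rw [← ENat.toENNReal_one, ENat.toENNReal_le]
    refine iSup_le fun C => iSup₂_le fun hC hC' => ?_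
    refine encard_le_one_iff.2 fun a b ha hb => ?_
    by_contra hab
    have h1 : (d : ℝ≥0∞) < edist a b := hC' ha hb hab
    have h2 := h a (hC ha).2 b (hC hb).2
    rw [edist_nndist] at h1
    exact absurd h2 (not_le.2 (by exact_mod_cast h1))
  calc meanPacking P d V ≤ ∫⁻ _, 1 ∂P := lintegral_mono key
    _ = 1 := by simp

/-- Stationarity is not part of the definition of the field; it enters here through translation
invariance of Lebesgue measure in the series over tuples. -/
theorem meanPacking_cube {P : Measure (Config n)} (hP : IsPoissonField 1 P) (d : ℝ≥0)
    (a b : Fin n → ℝ) {l : ℝ} (hl : 0 < l) :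
    meanPacking P d (cube a l) = meanPacking P d (cube b l) := by
  have h0 : ∀ a : Fin n → ℝ, volume (cube a l) ≠ 0 := fun a => by
    rw [volume_cube]
    exact pow_ne_zero _ (by simpa using hl)
  rw [meanPacking_eq_tsum hP (measurableSet_cube a l) (isBounded_cube a l) (h0 a),
    meanPacking_eq_tsum hP (measurableSet_cube b l) (isBounded_cube b l) (h0 b)]
  refine tsum_congr fun m => ?_
  rw [volume_cube, volume_cube]
  congr 1
  set c : Space n := WithLp.toLp 2 (b - a) with hc
  have hmp : MeasurePreserving (fun x : Fin m → Space n => x + fun _ => c) :=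
    measurePreserving_add_right volume _
  have hme : MeasurableEmbedding (fun x : Fin m → Space n => x + fun _ => c) :=
    measurableEmbedding_addRight _
  have hpre : (fun x : Fin m → Space n => x + fun _ => c) ⁻¹' (univ.pi fun _ => cube b l) =
      univ.pi fun _ => cube a l := by
    ext x
    simp only [mem_preimage, Set.mem_pi, mem_univ, forall_const, cube, mem_ofPred_eq,
      Pi.add_apply, PiLp.add_apply, hc, Pi.sub_apply]
    refine forall_congr' fun i => forall_congr' fun j => ?_
    constructor <;> rintro ⟨h1, h2⟩ <;> constructor <;> linarith
  rw [← hpre, ← hmp.setLIntegral_comp_preimage_emb hme _ (univ.pi fun _ => cube b l)]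
  refine lintegral_congr fun x => ?_
  have : range (x + fun _ => c) = IsometryEquiv.addRight c '' range x := by
    rw [← range_comp]
    rfl
  rw [this, packingNumber_image]

/-- First-moment counting: the sum of the measures of the `S i` is the integral of the number of `i`
with `x ∈ S i`, so a pointwise gain in terms of that number can be integrated. -/
theorem setLIntegral_add_sum_le {α ι : Type*} [MeasurableSpace α] {μ : Measure α} {U : Set α}
    (hU : MeasurableSet U) (s : Finset ι) {S : ι → Set α} (hS : ∀ i, MeasurableSet (S i))
    (hSU : ∀ i, S i ⊆ U) {f g : α → ℝ≥0∞} (hg : Measurable g)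
    (h : ∀ x ∈ U, ∀ t ⊆ s, (∀ i ∈ t, x ∈ S i) → g x + (t.card : ℝ≥0∞) ≤ f x) :
    (∫⁻ x in U, g x ∂μ) + ∑ i ∈ s, μ (S i) ≤ ∫⁻ x in U, f x ∂μ := by
  classical
  have h1 : ∑ i ∈ s, μ (S i) = ∫⁻ x in U, ∑ i ∈ s, (S i).indicator 1 x ∂μ := by
    rw [lintegral_finsetSum _ fun i _ => measurable_one.indicator (hS i)]
    refine Finset.sum_congr rfl fun i _ => ?_
    rw [lintegral_indicator_one (hS i), Measure.restrict_apply (hS i),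
      inter_eq_left.2 (hSU i)]
  rw [h1, ← lintegral_add_left hg]
  refine setLIntegral_mono' hU fun x hx => ?_
  refine le_trans (le_of_eq ?_) (h x hx (s.filter fun i => x ∈ S i) (Finset.filter_subset _ _)
    fun i hi => (Finset.mem_filter.1 hi).2)
  rw [Finset.card_filter]
  push_cast
  simp [indicator_apply]

theorem le_meanPacking {P : Measure (Config n)} (hP : IsPoissonField 1 P) {d : ℝ≥0}
    {V : Set (Space n)} (hV : MeasurableSet V) (hb : Bornology.IsBounded V)
    (hd : 0 < ballVol n d) (hdV : ballVol n d ≤ (volume V).toReal) :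
    ENNReal.ofReal ((volume V).toReal * ((1 - Real.exp (-ballVol n d)) / ballVol n d)) ≤
      meanPacking P d V := by
  set v := ballVol n d with hv
  set w := (volume V).toReal with hw
  have hw0 : 0 < w := hd.trans_le hdV
  have hVw : volume V = ENNReal.ofReal w := (ENNReal.ofReal_toReal hb.measure_lt_top.ne).symm
  have h0 : volume V ≠ 0 := by
    rw [hVw]
    simpa using hw0
  rw [meanPacking_eq_tsum hP hV hb h0]
  -- Summing w(w - v)ⁱw^(m-1-i) over the indices is a geometric sum, equal to (w/v)(wᵐ - (w - v)ᵐ);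
  -- summing over `m` then gives two exponential series.
  have hterm : ∀ m : ℕ, ENNReal.ofReal (Real.exp (-w) * (w / v) *
      (w ^ m / m.factorial - (w - v) ^ m / m.factorial)) ≤
      ENNReal.ofReal (Real.exp (-w) / m.factorial) *
        ∫⁻ x in univ.pi fun _ : Fin m => V, (Metric.packingNumber d (range x) : ℝ≥0∞) := by
    intro m
    rcases m with _ | M
    · simp
    have h1 : ∑ i : Fin (M + 1), volume {x : Fin (M + 1) → Space n |
        (∀ k, x k ∈ V) ∧ ∀ j < i, (d : ℝ≥0∞) < edist (x j) (x i)} ≤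
        ∫⁻ x in univ.pi fun _ : Fin (M + 1) => V, (Metric.packingNumber d (range x) : ℝ≥0∞) := by
      have := setLIntegral_add_sum_le (μ := (volume : Measure (Fin (M + 1) → Space n)))
        (MeasurableSet.univ_pi fun _ : Fin (M + 1) => hV)
        Finset.univ (fun i => measurableSet_firstInBall d hV i) (fun i x hx k _ => hx.1 k)
        (f := fun x => (Metric.packingNumber d (range x) : ℝ≥0∞)) (g := 0) measurable_zero (by
          intro x _ t _ ht
          rw [Pi.zero_apply, zero_add]
          have := card_firstInBall_le d x t fun i hi => (ht i hi).2
          exact_mod_cast ENat.toENNReal_le.2 this)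
      simpa using this
    refine le_trans ?_ (mul_le_mul_right ((Finset.sum_le_sum fun i _ =>
      le_volume_firstInBall d hV i).trans h1) _)
    have h2 : ∀ i : Fin (M + 1), volume V * ((volume V - ENNReal.ofReal (ballVol n d)) ^ (i : ℕ) *
        volume V ^ (M - i)) = ENNReal.ofReal (w * ((w - v) ^ (i : ℕ) * w ^ (M - i))) := by
      intro i
      have : 0 ≤ w - v := sub_nonneg.2 hdV
      rw [hVw, ← ENNReal.ofReal_sub _ hd.le, ← ENNReal.ofReal_pow this,
        ← ENNReal.ofReal_pow hw0.le, ← ENNReal.ofReal_mul (by positivity),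
        ← ENNReal.ofReal_mul hw0.le]
    have hnn : 0 ≤ w - v := sub_nonneg.2 hdV
    rw [Finset.sum_congr rfl fun i _ => h2 i, ← ENNReal.ofReal_sum_of_nonneg
      fun i _ => by positivity, ← ENNReal.ofReal_mul (by positivity), ← Finset.mul_sum]
    refine ENNReal.ofReal_le_ofReal (le_of_eq ?_)
    have h3 := geom_sum₂_mul (w - v) w (M + 1)
    rw [← Fin.sum_univ_eq_sum_range (fun i => (w - v) ^ i * w ^ (M + 1 - 1 - i))] at h3
    simp only [Nat.add_sub_cancel] at h3
    have h4 : ∑ i : Fin (M + 1), (w - v) ^ (i : ℕ) * w ^ (M - i) =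
        (w ^ (M + 1) - (w - v) ^ (M + 1)) / v := by
      rw [eq_div_iff hd.ne']
      linarith
    rw [h4]
    field_simp
  refine le_trans (le_of_eq ?_) (ENNReal.tsum_le_tsum hterm)
  have hs := ((NormedSpace.expSeries_div_hasSum_exp (𝔸 := ℝ) w).sub
    (NormedSpace.expSeries_div_hasSum_exp (𝔸 := ℝ) (w - v))).mul_left (Real.exp (-w) * (w / v))
  rw [← Real.exp_eq_exp_ℝ] at hs
  rw [← ENNReal.ofReal_tsum_of_nonneg _ hs.summable, hs.tsum_eq]
  · congr 1
    have e1 : Real.exp (-w) * Real.exp w = 1 := by rw [← Real.exp_add]; simp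
    have e2 : Real.exp (-w) * Real.exp (w - v) = Real.exp (-v) := by
      rw [← Real.exp_add]; congr 1; ring
    rw [← e1, ← e2]
    ring
  · intro m
    have : (w - v) ^ m ≤ w ^ m := pow_le_pow_left₀ (by linarith) (by linarith) m
    have : (w - v) ^ m / m.factorial ≤ w ^ m / m.factorial := by gcongr
    exact mul_nonneg (by positivity) (by linarith)

theorem card_filter_fst_lt_snd (m : ℕ) :
    ((Finset.univ.filter fun p : Fin m × Fin m => p.1 < p.2).card : ℝ) = m * (m - 1) / 2 := by
  have h1 : (Finset.univ.filter fun p : Fin m × Fin m => p.1 < p.2).card =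
      ∑ j : Fin m, (j : ℕ) := by
    rw [Finset.card_filter, Fintype.sum_prod_type_right]
    refine Finset.sum_congr rfl fun j _ => ?_
    rw [← Finset.card_filter]
    have : (Finset.univ.filter fun i : Fin m => i < j) = Finset.Iio j := by ext; simp
    rw [this, Fin.card_Iio]
  rw [h1, Fin.sum_univ_eq_sum_range fun i => i]
  have h2 := Finset.sum_range_id_mul_two m
  rcases m with _ | m
  · simp
  · rw [eq_div_iff two_ne_zero]
    have h3 : ((∑ i ∈ Finset.range (m + 1), i : ℕ) : ℝ) * 2 = (m + 1 : ℕ) * m := by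
      exact_mod_cast h2
    rw [h3]
    push_cast
    ring

/-- Integrates the gain from isolated pairs. The m(m - 1)/2 index pairs turn 1/m! into 1/(2(m -
2)!), and the series in (w - 2v)^(m-2) produces the factor e⁻²ᵛ. -/
theorem meanPacking_add_le {P : Measure (Config n)} (hP : IsPoissonField 1 P) {d' d : ℝ≥0}
    (hd : d' ≤ d) {V W : Set (Space n)} (hV : MeasurableSet V) (hb : Bornology.IsBounded V)
    (h0 : volume V ≠ 0) (hW : MeasurableSet W) (hWV : ∀ a ∈ W, Metric.closedBall a d ⊆ V)
    (hdV : 2 * ballVol n d ≤ (volume V).toReal) :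
    meanPacking P d V + ENNReal.ofReal ((volume W).toReal *
      ((ballVol n d - ballVol n d') / 2 * Real.exp (-2 * ballVol n d))) ≤
      meanPacking P d' V := by
  set v := ballVol n d with hv
  set v' := ballVol n d' with hv'
  set w := (volume V).toReal with hw
  set u := (volume W).toReal with hu
  have hWV' : W ⊆ V := fun a ha => hWV a ha (Metric.mem_closedBall_self d.2)
  have hVw : volume V = ENNReal.ofReal w := (ENNReal.ofReal_toReal hb.measure_lt_top.ne).symm
  have hWu : volume W = ENNReal.ofReal u :=
    (ENNReal.ofReal_toReal (hb.subset hWV').measure_lt_top.ne).symm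
  have hu0 : 0 ≤ u := ENNReal.toReal_nonneg
  have hvv : 0 ≤ v - v' := sub_nonneg.2 (ballVol_mono d'.2 (by exact_mod_cast hd))
  have hwv : 0 ≤ w - 2 * v := sub_nonneg.2 hdV
  rw [meanPacking_eq_tsum hP hV hb h0, meanPacking_eq_tsum hP hV hb h0]
  set B : ℕ → ℝ≥0∞ := fun m => ENNReal.ofReal (Real.exp (-w) / m.factorial) *
    ∑ p ∈ Finset.univ.filter (fun p : Fin m × Fin m => p.1 < p.2),
      volume {x : Fin m → Space n | (∀ k, x k ∈ V) ∧ IsIsolatedPair d' d x p.1 p.2} with hB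
  have hterm : ∀ m : ℕ, ENNReal.ofReal (Real.exp (-w) / m.factorial) *
        (∫⁻ x in univ.pi fun _ : Fin m => V, (Metric.packingNumber d (range x) : ℝ≥0∞)) + B m ≤
      ENNReal.ofReal (Real.exp (-w) / m.factorial) *
        ∫⁻ x in univ.pi fun _ : Fin m => V, (Metric.packingNumber d' (range x) : ℝ≥0∞) := by
    intro m
    simp only [hB]
    rw [← mul_add]
    refine mul_le_mul_right ?_ _
    have hsum := setLIntegral_add_sum_le (μ := (volume : Measure (Fin m → Space n)))
      (MeasurableSet.univ_pi fun _ : Fin m => hV)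
      (Finset.univ.filter (fun p : Fin m × Fin m => p.1 < p.2))
      (S := fun p => {x : Fin m → Space n | (∀ k, x k ∈ V) ∧ IsIsolatedPair d' d x p.1 p.2})
      (fun p => measurableSet_isolatedPair hV p.1 p.2) (fun p x hx k _ => hx.1 k)
      (g := fun x => (Metric.packingNumber d (range x) : ℝ≥0∞))
      (f := fun x => (Metric.packingNumber d' (range x) : ℝ≥0∞))
      (measurable_packingNumber_range d m) (by
        intro x _ t _ ht
        have := ENat.toENNReal_le.2
          (packingNumber_add_card_isolatedPair_le hd x t fun p hp => (ht p hp).2)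
        rwa [ENat.toENNReal_add, ENat.toENNReal_coe] at this)
    exact hsum
  refine le_trans ?_ (ENNReal.tsum_le_tsum hterm)
  rw [ENNReal.tsum_add]
  refine add_le_add_right ?_ _
  -- Tuples with fewer than two entries have no pairs, so the series may start at `m = M + 2`.
  refine le_trans ?_ (ENNReal.tsum_comp_le_tsum_of_injective (add_left_injective 2) B)
  have hBM : ∀ M : ℕ, ENNReal.ofReal (Real.exp (-w) * (u * ((v - v') / 2)) *
      ((w - 2 * v) ^ M / M.factorial)) ≤ B (M + 2) := by
    intro M
    have h1 : ∀ p ∈ Finset.univ.filter (fun p : Fin (M + 2) × Fin (M + 2) => p.1 < p.2),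
        ENNReal.ofReal (u * ((v - v') * (w - 2 * v) ^ M)) ≤ volume {x : Fin (M + 2) → Space n |
          (∀ k, x k ∈ V) ∧ IsIsolatedPair d' d x p.1 p.2} := by
      intro p hp
      have := le_volume_isolatedPair (d' := d') hV hW hWV p.1 p.2 (Finset.mem_filter.1 hp).2
      rwa [hVw, hWu, ← ENNReal.ofReal_sub _ (by positivity [ballVol_nonneg (n := n) d]),
        ← ENNReal.ofReal_pow hwv, ← ENNReal.ofReal_mul hvv, ← ENNReal.ofReal_mul hu0] at this
    refine le_trans (le_of_eq ?_) (mul_le_mul_right (Finset.sum_le_sum h1) _)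
    rw [Finset.sum_const, nsmul_eq_mul, ← ENNReal.ofReal_natCast,
      ← ENNReal.ofReal_mul (Nat.cast_nonneg _), ← ENNReal.ofReal_mul (by positivity),
      card_filter_fst_lt_snd, Nat.factorial_succ, Nat.factorial_succ]
    congr 1
    push_cast
    field_simp
    ring
  refine le_trans (le_of_eq ?_) (ENNReal.tsum_le_tsum hBM)
  have hs := (NormedSpace.expSeries_div_hasSum_exp (𝔸 := ℝ) (w - 2 * v)).mul_left
    (Real.exp (-w) * (u * ((v - v') / 2)))
  rw [← Real.exp_eq_exp_ℝ] at hs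
  rw [← ENNReal.ofReal_tsum_of_nonneg (fun m => by positivity) hs.summable, hs.tsum_eq]
  congr 1
  have e2 : Real.exp (-w) * Real.exp (w - 2 * v) = Real.exp (-2 * v) := by
    rw [← Real.exp_add]; congr 1; ring
  rw [← e2]
  ring

/-! ### A strong law over growing lattice cubes -/

/-- The integer points of `[-K, K) ^ n`. -/
noncomputable def latticeBox (n K : ℕ) : Finset (Fin n → ℤ) := Fintype.piFinset fun _ => Finset.Ico (-K : ℤ) K

theorem card_latticeBox (n K : ℕ) : ((latticeBox n K).card : ℝ) = (2 * K) ^ n := by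
  rw [latticeBox, Fintype.card_piFinset, Finset.prod_const, Int.card_Ico, Finset.card_univ,
    Fintype.card_fin]
  push_cast
  congr 1
  have : ((K : ℤ) - -K).toNat = 2 * K := by omega
  rw [this]
  push_cast
  ring

theorem latticeBox_mono (n : ℕ) : Monotone (latticeBox n) := by
  intro K L h z hz
  simp only [latticeBox, Fintype.mem_piFinset, Finset.mem_Ico] at hz ⊢
  intro i
  have := hz i
  omega

/-- Consecutive squares have ratio tending to 1, so monotonicity squeezes the values between them.
-/
theorem tendsto_div_of_monotone_of_tendsto_sq {u : ℕ → ℝ} (hu : Monotone u) (h0 : ∀ K, 0 ≤ u K)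
    (n : ℕ) {μ : ℝ}
    (h : Tendsto (fun k : ℕ => u (k ^ 2) / (2 * ((k ^ 2 : ℕ) : ℝ)) ^ n) atTop (𝓝 μ)) :
    Tendsto (fun K : ℕ => u K / (2 * (K : ℝ)) ^ n) atTop (𝓝 μ) := by
  have hsqrt : Tendsto Nat.sqrt atTop atTop := by
    refine tendsto_atTop.2 fun b => ?_
    filter_upwards [eventually_ge_atTop (b * b)] with a ha
    exact Nat.le_sqrt.2 ha
  have hr : Tendsto (fun k : ℕ => ((k : ℝ) / ((k : ℝ) + 1))) atTop (𝓝 1) :=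
    tendsto_natCast_div_add_atTop (1 : ℝ)
  have hlo : Tendsto (fun k : ℕ => u (k ^ 2) / (2 * ((k ^ 2 : ℕ) : ℝ)) ^ n *
      (((k : ℝ) / ((k : ℝ) + 1)) ^ 2) ^ n) atTop (𝓝 μ) := by
    simpa using h.mul ((hr.pow 2).pow n)
  have hhi : Tendsto (fun k : ℕ => u ((k + 1) ^ 2) / (2 * (((k + 1) ^ 2 : ℕ) : ℝ)) ^ n *
      ((((k : ℝ) / ((k : ℝ) + 1)) ^ 2) ^ n)⁻¹) atTop (𝓝 μ) := by
    have h1 := (tendsto_add_atTop_iff_nat 1).2 h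
    have h2 := ((hr.pow 2).pow n).inv₀ (by simp)
    simpa using h1.mul h2
  refine tendsto_of_tendsto_of_tendsto_of_le_of_le' (hlo.comp hsqrt) (hhi.comp hsqrt) ?_ ?_
  · filter_upwards [eventually_ge_atTop 1] with K hK
    have h1 : K.sqrt ^ 2 ≤ K := Nat.sqrt_le' K
    have h2 : K < (K.sqrt + 1) ^ 2 := Nat.lt_succ_sqrt' K
    have h3 : 1 ≤ K.sqrt := Nat.le_sqrt.2 (by omega)
    simp only [Function.comp_apply]
    set k := K.sqrt
    have hk : (0 : ℝ) < k := by exact_mod_cast h3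
    have h2' : (K : ℝ) ≤ (k + 1) ^ 2 := by exact_mod_cast h2.le
    have hK' : (0 : ℝ) < K := by exact_mod_cast hK
    calc u (k ^ 2) / (2 * ((k ^ 2 : ℕ) : ℝ)) ^ n * (((k : ℝ) / ((k : ℝ) + 1)) ^ 2) ^ n
        = u (k ^ 2) / (2 * ((k : ℝ) + 1) ^ 2) ^ n := by
          push_cast
          rw [div_mul_eq_mul_div, mul_div_assoc, ← div_pow,
            div_eq_mul_inv (u (k ^ 2)) ((2 * ((k : ℝ) + 1) ^ 2) ^ n), ← inv_pow]
          congr 2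
          field_simp
      _ ≤ u K / (2 * (K : ℝ)) ^ n := by
          gcongr
          · exact h0 _
          · exact hu h1
  · filter_upwards [eventually_ge_atTop 1] with K hK
    have h1 : K.sqrt ^ 2 ≤ K := Nat.sqrt_le' K
    have h2 : K < (K.sqrt + 1) ^ 2 := Nat.lt_succ_sqrt' K
    have h3 : 1 ≤ K.sqrt := Nat.le_sqrt.2 (by omega)
    simp only [Function.comp_apply]
    set k := K.sqrt
    have hk : (0 : ℝ) < k := by exact_mod_cast h3
    have h1' : (k : ℝ) ^ 2 ≤ K := by exact_mod_cast h1
    calc u K / (2 * (K : ℝ)) ^ n ≤ u ((k + 1) ^ 2) / (2 * (k : ℝ) ^ 2) ^ n := by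
          gcongr
          · exact h0 _
          · exact hu h2.le
      _ = u ((k + 1) ^ 2) / (2 * (((k + 1) ^ 2 : ℕ) : ℝ)) ^ n *
          ((((k : ℝ) / ((k : ℝ) + 1)) ^ 2) ^ n)⁻¹ := by
          push_cast
          rw [div_eq_mul_inv, div_eq_mul_inv, mul_assoc, ← mul_inv, ← mul_pow]
          congr 3
          field_simp

/-- A strong law of large numbers for averages over growing cubes in `ℤ ^ n`. -/
theorem ae_tendsto_latticeBox_average {Ω : Type*} [MeasurableSpace Ω] {P : Measure Ω}
    [IsProbabilityMeasure P] (hn : 1 ≤ n) {X : (Fin n → ℤ) → Ω → ℝ} (h0 : ∀ z ω, 0 ≤ X z ω)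
    (hL : ∀ z, MemLp (X z) 2 P) (hindep : Pairwise fun z w => IndepFun (X z) (X w) P) {μ B : ℝ}
    (hμ : ∀ z, ∫ ω, X z ω ∂P = μ) (hB : ∀ z, variance (X z) P ≤ B) :
    ∀ᵐ ω ∂P, Tendsto (fun K : ℕ => (∑ z ∈ latticeBox n K, X z ω) / (2 * (K : ℝ)) ^ n) atTop
      (𝓝 μ) := by
  have hB0 : 0 ≤ B := (variance_nonneg _ _).trans (hB 0)
  set S : ℕ → Ω → ℝ := fun K => ∑ z ∈ latticeBox n K, X z with hS
  have hSL : ∀ K, MemLp (S K) 2 P := fun K => memLp_finsetSum' _ fun z _ => hL z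
  have hmean : ∀ K, ∫ ω, S K ω ∂P = (2 * (K : ℝ)) ^ n * μ := by
    intro K
    simp only [hS, Finset.sum_apply]
    rw [integral_finsetSum _ fun z _ => (hL z).integrable one_le_two]
    simp [hμ, ← card_latticeBox]
  have hvar : ∀ K, variance (S K) P ≤ (2 * (K : ℝ)) ^ n * B := by
    intro K
    rw [hS, IndepFun.variance_sum (fun z _ => hL z) fun z _ w _ hzw => hindep hzw,
      ← card_latticeBox, ← nsmul_eq_mul]
    exact Finset.sum_le_card_nsmul _ _ _ fun z _ => hB z
  -- Pairwise independence makes the variance of the average at most `B` over the number of cells.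
  -- Along squares this is summable even for `n = 1`, which is why the subsequence is taken.
  have hmom : ∀ k : ℕ, ∫⁻ ω, ENNReal.ofReal
      ((S ((k + 1) ^ 2) ω / (2 * (((k + 1) ^ 2 : ℕ) : ℝ)) ^ n - μ) ^ 2) ∂P ≤
        ENNReal.ofReal (B * (1 / ((k + 1 : ℕ) : ℝ) ^ 2)) := by
    intro k
    set K := (k + 1) ^ 2 with hK
    set V : ℝ := (2 * (K : ℝ)) ^ n with hV
    have hKpos : (1 : ℝ) ≤ K := by exact_mod_cast Nat.one_le_pow _ _ (Nat.succ_pos k)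
    have hVpos : 0 < V := by positivity
    have e1 : ∀ ω, (S K ω / V - μ) ^ 2 = (V ^ 2)⁻¹ * (S K ω - ∫ ω', S K ω' ∂P) ^ 2 := by
      intro ω
      rw [hmean K]
      field_simp
      rw [hV]
      ring
    have hint : Integrable (fun ω => (S K ω - ∫ ω', S K ω' ∂P) ^ 2) P :=
      ((hSL K).sub (memLp_const _)).integrable_sq
    rw [lintegral_congr fun ω => by rw [e1 ω], ← ofReal_integral_eq_lintegral_ofReal
      (hint.const_mul _) (ae_of_all _ fun ω => by positivity), integral_const_mul,
      ← variance_eq_integral (hSL K).aemeasurable]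
    refine ENNReal.ofReal_le_ofReal ?_
    calc (V ^ 2)⁻¹ * variance (S K) P ≤ (V ^ 2)⁻¹ * (V * B) := by
          gcongr
          exact hvar K
      _ = B * (1 / V) := by field_simp
      _ ≤ B * (1 / ((k + 1 : ℕ) : ℝ) ^ 2) := by
          gcongr
          have : ((k + 1 : ℕ) : ℝ) ^ 2 = K := by rw [hK]; push_cast; ring
          rw [this, hV]
          calc (K : ℝ) ≤ 2 * K := by linarith
            _ ≤ (2 * (K : ℝ)) ^ n := le_self_pow₀ (by linarith) (by omega)
  have hmeas : ∀ k : ℕ, AEMeasurable (fun ω => ENNReal.ofReal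
      ((S ((k + 1) ^ 2) ω / (2 * (((k + 1) ^ 2 : ℕ) : ℝ)) ^ n - μ) ^ 2)) P := fun k =>
    ((((hSL _).aemeasurable.div_const _).sub_const μ).pow_const 2).ennreal_ofReal
  -- The sum of the squared deviations has finite mean, so it is finite almost surely and its terms
  -- tend to zero; no Borel–Cantelli argument is required.
  have hsum : ∫⁻ ω, ∑' k : ℕ, ENNReal.ofReal
      ((S ((k + 1) ^ 2) ω / (2 * (((k + 1) ^ 2 : ℕ) : ℝ)) ^ n - μ) ^ 2) ∂P ≠ ∞ := by
    rw [lintegral_tsum hmeas]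
    refine ((ENNReal.tsum_le_tsum hmom).trans_lt ?_).ne
    have hs : Summable fun k : ℕ => B * (1 / ((k + 1 : ℕ) : ℝ) ^ 2) :=
      ((summable_nat_add_iff 1).2 (Real.summable_one_div_nat_pow.2 one_lt_two)).mul_left B
    rw [← ENNReal.ofReal_tsum_of_nonneg (fun k => by positivity) hs]
    exact ENNReal.ofReal_lt_top
  filter_upwards [ae_lt_top' (AEMeasurable.tsum hmeas) hsum] with ω hω
  have h1 := ENNReal.tendsto_atTop_zero_of_tsum_ne_top hω.ne
  have h2 : Tendsto (fun k : ℕ =>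
      (S ((k + 1) ^ 2) ω / (2 * (((k + 1) ^ 2 : ℕ) : ℝ)) ^ n - μ) ^ 2) atTop (𝓝 0) := by
    have := (ENNReal.tendsto_toReal ENNReal.zero_ne_top).comp h1
    refine this.congr fun k => ?_
    simp only [Function.comp_apply]
    rw [ENNReal.toReal_ofReal (by positivity)]
  have h3 : Tendsto (fun k : ℕ =>
      S ((k + 1) ^ 2) ω / (2 * (((k + 1) ^ 2 : ℕ) : ℝ)) ^ n) atTop (𝓝 μ) := by
    have h4 := (Real.continuous_sqrt.tendsto _).comp h2
    rw [Real.sqrt_zero] at h4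
    rw [tendsto_iff_norm_sub_tendsto_zero]
    refine h4.congr fun k => ?_
    simp only [Function.comp_apply, Real.norm_eq_abs]
    rw [Real.sqrt_sq_eq_abs]
  have h4 := (tendsto_add_atTop_iff_nat (f := fun k : ℕ =>
      S (k ^ 2) ω / (2 * ((k ^ 2 : ℕ) : ℝ)) ^ n) 1).1 h3
  have h5 := tendsto_div_of_monotone_of_tendsto_sq (u := fun K => S K ω) (fun K L h => by
      simp only [hS, Finset.sum_apply]
      exact Finset.sum_le_sum_of_subset_of_nonneg (latticeBox_mono n h) fun z _ _ => h0 z ω)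
    (fun K => by
      simp only [hS, Finset.sum_apply]
      exact Finset.sum_nonneg fun z _ => h0 z ω) n h4
  simpa [hS, Finset.sum_apply] using h5

/-! ### Comparing the box with independent cubes -/

theorem disjoint_cube {L l : ℝ} (hL : 0 < L) (hl : l ≤ L) {z w : Fin n → ℤ} (h : z ≠ w) :
    Disjoint (cube (fun i => L * z i) l) (cube (fun i => L * w i) l) := by
  obtain ⟨i, hi⟩ := Function.ne_iff.1 h
  rw [Set.disjoint_left]
  intro x hx hy
  have h1 := hx i
  have h2 := hy i
  rcases lt_or_gt_of_ne hi with hlt | hlt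
  · have : (z i : ℝ) + 1 ≤ w i := by exact_mod_cast hlt
    nlinarith
  · have : (w i : ℝ) + 1 ≤ z i := by exact_mod_cast hlt
    nlinarith

theorem packingNumber_inter_ne_top (d : ℝ≥0) (σ : Config n) {V : Set (Space n)}
    (hb : Bornology.IsBounded V) : Metric.packingNumber d (σ.1 ∩ V) ≠ ⊤ :=
  ((Metric.packingNumber_le_encard_self _).trans_lt (σ.2 V hb).encard_lt_top).ne

theorem ae_tendsto_packing_average {P : Measure (Config n)} (hP : IsPoissonField 1 P)
    (hn : 1 ≤ n) (d : ℝ≥0) {L l : ℝ} (hl0 : 0 < l) (hl : l ≤ L) :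
    ∀ᵐ σ ∂P, Tendsto (fun K : ℕ => (∑ z ∈ latticeBox n K,
      (Metric.packingNumber d (σ.1 ∩ cube (fun i => L * z i) l) : ℝ≥0∞).toReal) /
        (2 * (K : ℝ)) ^ n) atTop (𝓝 (meanPacking P d (cube 0 l)).toReal) := by
  have := hP.isProbabilityMeasure
  have hsq : ∀ z : Fin n → ℤ, ∫⁻ σ : Config n, (Metric.packingNumber d
      (σ.1 ∩ cube (fun i => L * z i) l) : ℝ≥0∞) ^ 2 ∂P ≤ ENNReal.ofReal (Real.exp (3 * l ^ n)) := by
    intro z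
    have h := lintegral_encard_sq_le hP (measurableSet_cube (fun i => L * (z i : ℝ)) l)
      (isBounded_cube _ _)
    rw [volume_cube, ENNReal.toReal_pow, ENNReal.toReal_ofReal hl0.le] at h
    refine le_trans (lintegral_mono fun σ => ?_) h
    have := ENat.toENNReal_le.2 (Metric.packingNumber_le_encard_self (ε := d)
      (σ.1 ∩ cube (fun i => L * (z i : ℝ)) l))
    gcongr
  have hmeas : ∀ z : Fin n → ℤ, Measurable fun σ : Config n =>
      (Metric.packingNumber d (σ.1 ∩ cube (fun i => L * z i) l) : ℝ≥0∞).toReal := fun z =>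
    (measurable_packingNumber_inter d (measurableSet_cube _ _)).ennreal_toReal
  have hne : ∀ (z : Fin n → ℤ) (σ : Config n),
      (Metric.packingNumber d (σ.1 ∩ cube (fun i => L * z i) l) : ℝ≥0∞) ≠ ∞ := fun z σ =>
    ENat.toENNReal_ne_top.2 (packingNumber_inter_ne_top d σ (isBounded_cube _ _))
  have hofReal : ∀ (z : Fin n → ℤ) (σ : Config n), ENNReal.ofReal
      ((Metric.packingNumber d (σ.1 ∩ cube (fun i => L * z i) l) : ℝ≥0∞).toReal ^ 2) =
      (Metric.packingNumber d (σ.1 ∩ cube (fun i => L * z i) l) : ℝ≥0∞) ^ 2 := fun z σ => by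
    rw [ENNReal.ofReal_pow ENNReal.toReal_nonneg, ENNReal.ofReal_toReal (hne z σ)]
  have hint : ∀ z : Fin n → ℤ, Integrable (fun σ : Config n =>
      (Metric.packingNumber d (σ.1 ∩ cube (fun i => L * z i) l) : ℝ≥0∞).toReal ^ 2) P := by
    intro z
    refine ⟨((hmeas z).pow_const 2).aestronglyMeasurable, ?_⟩
    rw [hasFiniteIntegral_iff_ofReal (ae_of_all _ fun σ => by positivity),
      lintegral_congr fun σ => hofReal z σ]
    exact (hsq z).trans_lt ENNReal.ofReal_lt_top
  refine ae_tendsto_latticeBox_average hn (fun z σ => ENNReal.toReal_nonneg)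
    (fun z => (memLp_two_iff_integrable_sq (hmeas z).aestronglyMeasurable).2 (hint z)) ?_
    (fun z => ?_) (B := Real.exp (3 * l ^ n)) fun z => ?_
  · intro z w hzw
    have hi := hP.indep _ _ (measurableSet_cube (fun i => L * (z i : ℝ)) l)
      (measurableSet_cube (fun i => L * (w i : ℝ)) l) (disjoint_cube (hl0.trans_le hl) hl hzw)
    have hg : Measurable fun σ : Config n => (Metric.packingNumber d σ.1 : ℝ≥0∞).toReal :=
      (measurable_toENNReal_packingNumber d).ennreal_toReal
    exact hi.comp hg hg
  · rw [integral_toReal (measurable_packingNumber_inter d (measurableSet_cube _ _)).aemeasurable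
      (ae_of_all _ fun σ => (hne z σ).lt_top)]
    exact congrArg ENNReal.toReal (meanPacking_cube hP d _ 0 hl0)
  · refine (variance_le_expectation_sq (hmeas z).aestronglyMeasurable).trans ?_
    have h1 := ofReal_integral_eq_lintegral_ofReal (hint z) (ae_of_all _ fun σ => by positivity)
    rw [lintegral_congr fun σ => hofReal z σ] at h1
    have h2 := hsq z
    rw [← h1, ENNReal.ofReal_le_ofReal_iff (Real.exp_pos _).le] at h2
    exact h2

/-- The largest number of points of `σ` in the cube of side `2 N` with distances above `d`. -/
noncomputable def packingCount (d : ℝ≥0) (N : ℝ) (σ : Config n) : ℝ :=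
  (Metric.packingNumber d (σ.1 ∩ box n N) : ℝ≥0∞).toReal

theorem box_subset_biUnion_cube {N L : ℝ} (hL : 0 < L) :
    box n N ⊆ ⋃ z ∈ latticeBox n (⌊N / L⌋₊ + 1), cube (fun i => L * (z i : ℝ)) L := by
  intro x hx
  refine mem_iUnion₂.2 ⟨fun i => ⌊x i / L⌋, ?_, fun i => ?_⟩
  · simp only [latticeBox, Fintype.mem_piFinset, Finset.mem_Ico]
    intro i
    have h1 := abs_le.1 (hx i)
    have h2 := Nat.lt_floor_add_one (N / L)
    have h3 : x i / L ≤ N / L := by gcongr; exact h1.2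
    have h4 : -(N / L) ≤ x i / L := by rw [← neg_div]; gcongr; exact h1.1
    constructor
    · rw [Int.le_floor]
      push_cast
      linarith
    · rw [Int.floor_lt]
      push_cast
      linarith
  · have h1 := Int.floor_le (x i / L)
    have h2 := Int.lt_floor_add_one (x i / L)
    rw [le_div_iff₀ hL] at h1
    rw [div_lt_iff₀ hL] at h2
    constructor <;> nlinarith

theorem biUnion_cube_subset_box {N L l : ℝ} (hN : 0 ≤ N) (hL : 0 < L) (hl : l ≤ L) :
    ⋃ z ∈ latticeBox n ⌊N / L⌋₊, cube (fun i => L * (z i : ℝ)) l ⊆ box n N := by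
  intro x hx i
  obtain ⟨z, hz, hx⟩ := mem_iUnion₂.1 hx
  simp only [latticeBox, Fintype.mem_piFinset, Finset.mem_Ico] at hz
  have h1 := Nat.floor_le (div_nonneg hN hL.le)
  rw [le_div_iff₀ hL] at h1
  have h2 : -(⌊N / L⌋₊ : ℝ) ≤ z i := by exact_mod_cast (hz i).1
  have h3 : (z i : ℝ) + 1 ≤ ⌊N / L⌋₊ := by exact_mod_cast (hz i).2
  have h4 := hx i
  rw [abs_le]
  constructor <;> nlinarith

/-- The corridors have width at least `d`, and half-openness of the cubes makes the inequality
strict, as the definition of a packing requires. -/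
theorem lt_edist_of_mem_cube {L l : ℝ} {d : ℝ≥0} (hL : 0 < L) (hl : l + d ≤ L)
    {z w : Fin n → ℤ} (h : z ≠ w) {x y : Space n} (hx : x ∈ cube (fun i => L * (z i : ℝ)) l)
    (hy : y ∈ cube (fun i => L * (w i : ℝ)) l) : (d : ℝ≥0∞) < edist x y := by
  have key : (d : ℝ) < dist x y := by
    obtain ⟨i, hi⟩ := Function.ne_iff.1 h
    refine lt_of_lt_of_le ?_ (abs_apply_sub_le_dist x y i)
    have h1 := hx i
    have h2 := hy i
    rcases lt_or_gt_of_ne hi with hlt | hlt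
    · have : (z i : ℝ) + 1 ≤ w i := by exact_mod_cast hlt
      refine lt_of_lt_of_le ?_ (neg_le_abs _)
      nlinarith
    · have : (w i : ℝ) + 1 ≤ z i := by exact_mod_cast hlt
      refine lt_of_lt_of_le ?_ (le_abs_self _)
      nlinarith
  rw [edist_nndist]
  exact_mod_cast key

theorem packingCount_le_sum (d : ℝ≥0) {N L : ℝ} (hL : 0 < L) (σ : Config n) :
    packingCount d N σ ≤ ∑ z ∈ latticeBox n (⌊N / L⌋₊ + 1),
      (Metric.packingNumber d (σ.1 ∩ cube (fun i => L * z i) L) : ℝ≥0∞).toReal := by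
  have hne : ∀ z : Fin n → ℤ,
      (Metric.packingNumber d (σ.1 ∩ cube (fun i => L * z i) L) : ℝ≥0∞) ≠ ∞ := fun z =>
    ENat.toENNReal_ne_top.2 (packingNumber_inter_ne_top d σ (isBounded_cube _ _))
  rw [← ENNReal.toReal_sum fun z _ => hne z]
  refine ENNReal.toReal_mono (ENNReal.sum_ne_top.2 fun z _ => hne z) ?_
  have h1 : Metric.packingNumber d (σ.1 ∩ box n N) ≤ ∑ z ∈ latticeBox n (⌊N / L⌋₊ + 1),
      Metric.packingNumber d (σ.1 ∩ cube (fun i => L * z i) L) := by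
    refine (packingNumber_mono_set (inter_subset_inter_right σ.1
      (box_subset_biUnion_cube (N := N) hL))).trans ?_
    rw [inter_iUnion₂]
    exact packingNumber_biUnion_le d _ _
  refine (ENat.toENNReal_le.2 h1).trans (le_of_eq ?_)
  exact map_sum (ENat.toENNRealRingHom) _ _

theorem sum_le_packingCount (d : ℝ≥0) {N L l : ℝ} (hN : 0 ≤ N) (hL : 0 < L) (hl : l + d ≤ L)
    (σ : Config n) :
    ∑ z ∈ latticeBox n ⌊N / L⌋₊,
      (Metric.packingNumber d (σ.1 ∩ cube (fun i => L * z i) l) : ℝ≥0∞).toReal ≤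
        packingCount d N σ := by
  have hne : ∀ z : Fin n → ℤ,
      (Metric.packingNumber d (σ.1 ∩ cube (fun i => L * z i) l) : ℝ≥0∞) ≠ ∞ := fun z =>
    ENat.toENNReal_ne_top.2 (packingNumber_inter_ne_top d σ (isBounded_cube _ _))
  rw [← ENNReal.toReal_sum fun z _ => hne z]
  refine ENNReal.toReal_mono (ENat.toENNReal_ne_top.2
    (packingNumber_inter_ne_top d σ (isBounded_box _))) ?_
  have h1 : ∑ z ∈ latticeBox n ⌊N / L⌋₊,
      Metric.packingNumber d (σ.1 ∩ cube (fun i => L * z i) l) ≤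
        Metric.packingNumber d (σ.1 ∩ box n N) := by
    refine (sum_le_packingNumber_biUnion (d := d) (latticeBox n ⌊N / L⌋₊)
      (fun z => σ.1 ∩ cube (fun i => L * (z i : ℝ)) l) fun z _ w _ hzw a ha b hb =>
        lt_edist_of_mem_cube hL hl hzw ha.2 hb.2).trans ?_
    rw [← inter_iUnion₂]
    exact packingNumber_mono_set (inter_subset_inter_right σ.1
      (biUnion_cube_subset_box hN hL (by linarith [d.2])))
  refine le_trans (le_of_eq ?_) (ENat.toENNReal_le.2 h1)
  exact (map_sum (ENat.toENNRealRingHom) _ _).symm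

theorem tendsto_floor_add_div (L : ℝ) (hL : 0 < L) (c : ℝ) :
    Tendsto (fun N : ℝ => ((⌊N / L⌋₊ : ℝ) + c) / N) atTop (𝓝 (1 / L)) := by
  have h1 : Tendsto (fun N : ℝ => (⌊N / L⌋₊ : ℝ) / (N / L)) atTop (𝓝 1) :=
    (tendsto_nat_floor_div_atTop (R := ℝ)).comp (tendsto_id.atTop_div_const hL)
  have h2 : Tendsto (fun N : ℝ => c / N) atTop (𝓝 0) := tendsto_const_nhds.div_atTop tendsto_id
  have h3 := (h1.mul_const (1 / L)).add h2
  rw [one_mul, add_zero] at h3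
  refine h3.congr' ?_
  filter_upwards [eventually_gt_atTop 0] with N hN
  field_simp

theorem ae_packingCount_le {P : Measure (Config n)} (hP : IsPoissonField 1 P)
    (hn : 1 ≤ n) (d : ℝ≥0) {L : ℝ} (hL : 0 < L) :
    ∀ᵐ σ ∂P, ∀ c, (meanPacking P d (cube 0 L)).toReal / L ^ n < c →
      ∀ᶠ N : ℝ in atTop, packingCount d N σ / (2 * N) ^ n < c := by
  filter_upwards [ae_tendsto_packing_average hP hn d hL le_rfl] with σ hσ c hc
  have hK : Tendsto (fun N : ℝ => ⌊N / L⌋₊ + 1) atTop atTop :=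
    (tendsto_add_atTop_nat 1).comp
      (tendsto_nat_floor_atTop.comp (tendsto_id.atTop_div_const hL))
  have h1 := (hσ.comp hK).mul ((tendsto_floor_add_div L hL 1).pow n)
  rw [one_div, inv_pow, ← div_eq_mul_inv] at h1
  filter_upwards [h1.eventually (gt_mem_nhds hc), eventually_gt_atTop 0] with N hN hN0
  refine lt_of_le_of_lt ?_ hN
  refine (div_le_div_of_nonneg_right (packingCount_le_sum d hL σ) (by positivity)).trans ?_
  refine le_of_eq ?_
  simp only [Function.comp_apply]
  push_cast
  have hpos : (0 : ℝ) < (⌊N / L⌋₊ : ℝ) + 1 := by positivity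
  rw [div_pow, mul_pow, mul_pow]
  field_simp

theorem ae_le_packingCount {P : Measure (Config n)} (hP : IsPoissonField 1 P)
    (hn : 1 ≤ n) (d : ℝ≥0) {L : ℝ} (hL : d < L) :
    ∀ᵐ σ ∂P, ∀ c, c < (meanPacking P d (cube 0 (L - d))).toReal / L ^ n →
      ∀ᶠ N : ℝ in atTop, c < packingCount d N σ / (2 * N) ^ n := by
  have hL0 : 0 < L := d.2.trans_lt hL
  filter_upwards [ae_tendsto_packing_average hP hn d (sub_pos.2 hL) (sub_le_self L d.2)]
    with σ hσ c hc
  have hK : Tendsto (fun N : ℝ => ⌊N / L⌋₊) atTop atTop :=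
    tendsto_nat_floor_atTop.comp (tendsto_id.atTop_div_const hL0)
  have h1 := (hσ.comp hK).mul ((tendsto_floor_add_div L hL0 0).pow n)
  rw [one_div, inv_pow, ← div_eq_mul_inv] at h1
  filter_upwards [h1.eventually (lt_mem_nhds hc), eventually_gt_atTop 0,
    (tendsto_id.atTop_div_const hL0).eventually_ge_atTop 1] with N hN hN0 hN1
  refine lt_of_lt_of_le hN ?_
  refine le_trans (le_of_eq ?_) (div_le_div_of_nonneg_right
    (sum_le_packingCount d hN0.le hL0 (sub_add_cancel L (d : ℝ)).le σ) (by positivity))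
  simp only [Function.comp_apply, add_zero]
  have hpos : (0 : ℝ) < (⌊N / L⌋₊ : ℝ) := by
    exact_mod_cast Nat.floor_pos.2 hN1
  rw [div_pow, mul_pow, mul_pow]
  field_simp

theorem meanPacking_ne_top {P : Measure (Config n)} (hP : IsPoissonField 1 P) (d : ℝ≥0)
    {V : Set (Space n)} (hV : MeasurableSet V) (hb : Bornology.IsBounded V) :
    meanPacking P d V ≠ ∞ := by
  refine ne_top_of_le_ne_top (hb.measure_lt_top (μ := volume)).ne ?_
  rw [← lintegral_encard_eq hP hV hb]
  exact lintegral_mono fun σ => ENat.toENNReal_le.2 (Metric.packingNumber_le_encard_self _)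

/-- Removing a corridor costs at most the expected number of points in it, that is, its volume. -/
theorem meanPacking_cube_sub_le {P : Measure (Config n)} (hP : IsPoissonField 1 P) (d : ℝ≥0)
    {L : ℝ} (hL : d < L) :
    (meanPacking P d (cube 0 L)).toReal - (L ^ n - (L - d) ^ n) ≤
      (meanPacking P d (cube 0 (L - d))).toReal := by
  have hL0 : 0 < L := d.2.trans_lt hL
  have hsub : cube (0 : Fin n → ℝ) (L - d) ⊆ cube 0 L := fun x hx i =>
    ⟨(hx i).1, (hx i).2.trans_le (by linarith [d.2])⟩
  have h1 := meanPacking_le_add hP d (measurableSet_cube 0 L) (isBounded_cube 0 L)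
    (measurableSet_cube 0 (L - d)) hsub
  rw [measure_sdiff hsub (measurableSet_cube _ _).nullMeasurableSet
    (isBounded_cube _ _).measure_lt_top.ne, volume_cube, volume_cube,
    ← ENNReal.ofReal_pow hL0.le, ← ENNReal.ofReal_pow (sub_nonneg.2 hL.le),
    ← ENNReal.ofReal_sub _ (pow_nonneg (sub_nonneg.2 hL.le) _)] at h1
  have h2 := ENNReal.toReal_mono (ENNReal.add_ne_top.2
    ⟨meanPacking_ne_top hP d (measurableSet_cube _ _) (isBounded_cube _ _),
      ENNReal.ofReal_ne_top⟩) h1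
  rw [ENNReal.toReal_add (meanPacking_ne_top hP d (measurableSet_cube _ _) (isBounded_cube _ _))
    ENNReal.ofReal_ne_top, ENNReal.toReal_ofReal] at h2
  · linarith
  · exact sub_nonneg.2 (pow_le_pow_left₀ (sub_nonneg.2 hL.le) (by linarith [d.2]) n)

theorem tendsto_sub_div_pow (d : ℝ) :
    Tendsto (fun L : ℕ => ((L : ℝ) - d) ^ n / (L : ℝ) ^ n) atTop (𝓝 1) := by
  have h : Tendsto (fun L : ℕ => d / (L : ℝ)) atTop (𝓝 0) := tendsto_const_div_atTop_nhds_zero_nat d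
  have h1 := (h.const_sub 1).pow n
  rw [sub_zero, one_pow] at h1
  refine h1.congr' ?_
  filter_upwards [eventually_ge_atTop 1] with L hL
  have : (L : ℝ) ≠ 0 := by positivity
  rw [← div_pow]
  congr 1
  field_simp

/-! ### The asymptotic packing density and its bounds -/

/-- The maximal number of points with distances above `d` has an asymptotic density. -/
theorem exists_packing_density {P : Measure (Config n)} (hP : IsPoissonField 1 P) (hn : 1 ≤ n)
    (d : ℝ≥0) : ∃ ι : ℝ,
      (∀ᵐ σ ∂P, Tendsto (fun N : ℝ => packingCount d N σ / (2 * N) ^ n) atTop (𝓝 ι)) ∧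
      Tendsto (fun L : ℕ => (meanPacking P d (cube 0 L)).toReal / (L : ℝ) ^ n) atTop (𝓝 ι) ∧
      ∀ L : ℕ, 1 ≤ L → ι ≤ (meanPacking P d (cube 0 L)).toReal / (L : ℝ) ^ n := by
  have := hP.isProbabilityMeasure
  set a : ℕ → ℝ := fun L => (meanPacking P d (cube 0 L)).toReal / (L : ℝ) ^ n with ha
  set c : ℕ → ℝ := fun L => 1 - ((L : ℝ) - d) ^ n / (L : ℝ) ^ n with hc
  have hc0 : Tendsto c atTop (𝓝 0) := by
    have := (tendsto_sub_div_pow (n := n) (d : ℝ)).const_sub 1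
    rwa [sub_self] at this
  have hupper : ∀ᵐ σ ∂P, ∀ L : ℕ, 1 ≤ L → ∀ t, a L < t →
      ∀ᶠ N : ℝ in atTop, packingCount d N σ / (2 * N) ^ n < t := by
    refine ae_all_iff.2 fun L => ?_
    by_cases hL : 1 ≤ L
    · filter_upwards [ae_packingCount_le hP hn d (L := L) (by positivity)] with σ hσ _
      exact hσ
    · exact ae_of_all _ fun σ h => absurd h hL
  have hlower : ∀ᵐ σ ∂P, ∀ L : ℕ, d < L → ∀ t, t < a L - c L →
      ∀ᶠ N : ℝ in atTop, t < packingCount d N σ / (2 * N) ^ n := by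
    refine ae_all_iff.2 fun L => ?_
    by_cases hL : d < L
    · have hL' : (d : ℝ) < L := by exact_mod_cast hL
      have hL0 : (0 : ℝ) < L := d.2.trans_lt hL'
      filter_upwards [ae_le_packingCount hP hn d hL'] with σ hσ _ t ht
      refine hσ t (ht.trans_le ?_)
      have h1 := div_le_div_of_nonneg_right (meanPacking_cube_sub_le hP d hL')
        (by positivity : (0 : ℝ) ≤ (L : ℝ) ^ n)
      refine le_trans (le_of_eq ?_) h1
      simp only [ha, hc]
      field_simp
    · exact ae_of_all _ fun σ h => absurd h hL
  -- A deterministic comparison of two scales, read off from a single typical σ: its packing counts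
  -- are eventually below anything above `a L'` and above anything below `a L - c L`. Hence `a`
  -- converges to its infimum.
  have hac : ∀ L : ℕ, d < L → ∀ L' : ℕ, 1 ≤ L' → a L - c L ≤ a L' := by
    obtain ⟨σ, h1, h2⟩ := (hupper.and hlower).exists
    intro L hL L' hL'
    by_contra! hlt
    obtain ⟨t, ht1, ht2⟩ := exists_between hlt
    obtain ⟨N, hN1, hN2⟩ := ((h1 L' hL' t ht1).and (h2 L hL t ht2)).exists
    exact absurd hN1 (not_lt.2 hN2.le)
  set ι : ℝ := ⨅ L : {L : ℕ // 1 ≤ L}, a L with hι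
  have : Nonempty {L : ℕ // 1 ≤ L} := ⟨⟨1, le_rfl⟩⟩
  have hle : ∀ L : ℕ, 1 ≤ L → ι ≤ a L := fun L hL =>
    ciInf_le (f := fun L : {L : ℕ // 1 ≤ L} => a L)
      ⟨0, by rintro _ ⟨L, rfl⟩; simp only [ha]; positivity⟩ ⟨L, hL⟩
  have hge : ∀ L : ℕ, d < L → a L - c L ≤ ι := fun L hL => le_ciInf fun L' => hac L hL L' L'.2
  have hdL : ∀ᶠ L : ℕ in atTop, d < L := by
    obtain ⟨m, hm⟩ := exists_nat_gt d
    filter_upwards [eventually_ge_atTop m] with L hL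
    exact hm.trans_le (by exact_mod_cast hL)
  have hlim : Tendsto a atTop (𝓝 ι) := by
    have h1 : Tendsto (fun L => ι + c L) atTop (𝓝 ι) := by simpa using hc0.const_add ι
    refine tendsto_of_tendsto_of_tendsto_of_le_of_le' tendsto_const_nhds h1 ?_ ?_
    · filter_upwards [eventually_ge_atTop 1] with L hL using hle L hL
    · filter_upwards [hdL] with L hL
      linarith [hge L hL]
  refine ⟨ι, ?_, hlim, hle⟩
  filter_upwards [hupper, hlower] with σ h1 h2
  refine tendsto_order.2 ⟨fun t ht => ?_, fun t ht => ?_⟩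
  · have h3 : Tendsto (fun L => a L - c L) atTop (𝓝 ι) := by simpa using hlim.sub hc0
    obtain ⟨L, hL, hL'⟩ := ((h3.eventually (lt_mem_nhds ht)).and hdL).exists
    exact h2 L hL' t hL
  · obtain ⟨L, hL, hL'⟩ := ((hlim.eventually (gt_mem_nhds ht)).and (eventually_ge_atTop 1)).exists
    exact h1 L hL' t hL

/-- Multiplied by `v * exp v`, the inequality becomes `0 ≤ g v`. Here `g 0 = 0`, and the derivative
of `g` is nonnegative on the half-line because exp(-x) ≥ 1 - x. -/
theorem one_sub_sub_le_one_sub_exp_div {v : ℝ} (hv : 0 < v) :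
    1 - v / 3 - v / 6 * Real.exp (-v) ≤ (1 - Real.exp (-v)) / v := by
  set g : ℝ → ℝ := fun v => Real.exp v * (1 - v + v ^ 2 / 3) - 1 + v ^ 2 / 6 with hg
  have hd : ∀ x, HasDerivAt g (x / 3 * (Real.exp x * (x - 1) + 1)) x := by
    intro x
    have h1 : HasDerivAt (fun v : ℝ => 1 - v + v ^ 2 / 3) (-1 + 2 * x / 3) x := by
      have := ((hasDerivAt_id x).const_sub 1).add (((hasDerivAt_id x).pow 2).div_const 3)
      convert! this using 1
      simp
    have h2 := (((Real.hasDerivAt_exp x).mul h1).sub_const 1).add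
      (((hasDerivAt_id x).pow 2).div_const 6)
    convert! h2 using 1
    simp
    ring
  have hmono : MonotoneOn g (Ici 0) := by
    refine monotoneOn_of_deriv_nonneg (convex_Ici 0)
      (fun x _ => (hd x).continuousAt.continuousWithinAt)
      (fun x _ => (hd x).differentiableAt.differentiableWithinAt) fun x hx => ?_
    rw [interior_Ici, mem_Ioi] at hx
    rw [(hd x).deriv]
    have h1 := Real.add_one_le_exp (-x)
    have h2 : Real.exp x * Real.exp (-x) = 1 := by rw [← Real.exp_add]; simp
    have h3 := Real.exp_pos x
    have : 0 ≤ Real.exp x * (x - 1) + 1 := by nlinarith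
    positivity
  have h0 : 0 ≤ g v := by
    have := hmono (mem_Ici.2 le_rfl) (mem_Ici.2 hv.le) hv.le
    simpa [hg] using this
  rw [le_div_iff₀ hv]
  have h2 : Real.exp v * Real.exp (-v) = 1 := by rw [← Real.exp_add]; simp
  have h3 := Real.exp_pos (-v)
  have h4 : 0 ≤ Real.exp (-v) * g v := mul_nonneg h3.le h0
  have h5 : Real.exp (-v) * g v =
      1 - v + v ^ 2 / 3 - Real.exp (-v) + Real.exp (-v) * (v ^ 2 / 6) := by
    simp only [hg]
    linear_combination (1 - v + v ^ 2 / 3) * h2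
  nlinarith

theorem nu1_le_nu3 (d : ℝ) : nu1 n d ≤ nu3 n d := by
  have h0 := ballVol_nonneg (n := n) d
  have h1 : Real.exp (-ballVol n d) ≤ 1 := Real.exp_le_one_iff.2 (by linarith)
  unfold nu1 nu3
  nlinarith

theorem exists_packing_density_function {P : Measure (Config n)} (hP : IsPoissonField 1 P)
    (hn : 1 ≤ n) : ∃ ι : ℝ≥0 → ℝ,
      (∀ d, ∀ᵐ σ ∂P, Tendsto (fun N : ℝ => packingCount d N σ / (2 * N) ^ n) atTop (𝓝 (ι d))) ∧
      ι 0 = 1 ∧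
      (∀ d' d : ℝ≥0, d' ≤ d → ι d +
        (ballVol n d - ballVol n d') / 2 * Real.exp (-2 * ballVol n d) ≤ ι d') ∧
      (∀ d : ℝ≥0, 0 < d → (1 - Real.exp (-ballVol n d)) / ballVol n d ≤ ι d) ∧
      ∀ ν : ℝ, 0 < ν → ∃ d, ι d < ν := by
  have := hP.isProbabilityMeasure
  choose ι hι hlim hle using exists_packing_density hP hn
  have hvol : ∀ L : ℕ, (volume (cube (0 : Fin n → ℝ) L)).toReal = (L : ℝ) ^ n := fun L => by
    rw [volume_cube, ENNReal.toReal_pow, ENNReal.toReal_ofReal (by positivity)]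
  have hpow : Tendsto (fun L : ℕ => (L : ℝ) ^ n) atTop atTop :=
    (tendsto_pow_atTop (by omega)).comp tendsto_natCast_atTop_atTop
  refine ⟨ι, hι, ?_, fun d' d hd => ?_, fun d hd => ?_, fun ν hν => ?_⟩
  · refine tendsto_nhds_unique (hlim 0) (tendsto_const_nhds.congr' ?_)
    filter_upwards [eventually_ge_atTop 1] with L hL
    rw [meanPacking_zero hP (measurableSet_cube _ _) (isBounded_cube _ _), hvol, div_self]
    positivity
  · set C := (ballVol n d - ballVol n d') / 2 * Real.exp (-2 * ballVol n d) with hC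
    have hC0 : 0 ≤ C := by
      have := ballVol_mono (n := n) d'.2 (show (d' : ℝ) ≤ d by exact_mod_cast hd)
      have : 0 ≤ ballVol n d - ballVol n d' := sub_nonneg.2 this
      positivity
    have h1 := (hlim d).add ((tendsto_sub_div_pow (n := n) (2 * d)).mul_const C)
    rw [one_mul] at h1
    refine le_of_tendsto_of_tendsto h1 (hlim d') ?_
    filter_upwards [hpow.eventually_ge_atTop (2 * ballVol n d), eventually_ge_atTop 1,
      tendsto_natCast_atTop_atTop.eventually_ge_atTop (2 * (d : ℝ))] with L hL hL1 hLd
    have hL0 : (0 : ℝ) < L := by positivity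
    have h2 := meanPacking_add_le hP hd (measurableSet_cube (0 : Fin n → ℝ) L) (isBounded_cube _ _)
      (by rw [volume_cube]; exact pow_ne_zero _ (ENNReal.ofReal_pos.2 hL0).ne')
      -- The set `W` is the cube shrunk by `d` on every side, so balls of radius `d` around its
      -- points stay inside; its relative volume tends to 1.
      (measurableSet_cube (fun _ => (d : ℝ)) (L - 2 * d)) (fun a ha x hx i => by
        have h3 := abs_le.1 ((abs_apply_sub_le_dist x a i).trans (Metric.mem_closedBall.1 hx))
        have h4 := ha i
        constructor
        · simp only [Pi.zero_apply]; linarith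
        · simp only [Pi.zero_apply]; linarith) (by rwa [hvol])
    have hne := fun d => meanPacking_ne_top hP d (measurableSet_cube (0 : Fin n → ℝ) L)
      (isBounded_cube _ _)
    have h3 := ENNReal.toReal_mono (hne d') h2
    rw [volume_cube, ENNReal.toReal_pow, ENNReal.toReal_ofReal (sub_nonneg.2 hLd), ← hC,
      ENNReal.toReal_add (hne d) ENNReal.ofReal_ne_top, ENNReal.toReal_ofReal (mul_nonneg
        (pow_nonneg (sub_nonneg.2 hLd) _) hC0)] at h3
    rw [div_mul_eq_mul_div, ← add_div]
    gcongr
  · have hv := ballVol_pos (n := n) (show (0 : ℝ) < d by exact_mod_cast hd)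
    refine ge_of_tendsto (hlim d) ?_
    filter_upwards [hpow.eventually_ge_atTop (ballVol n d), eventually_ge_atTop 1] with L hL hL1
    have h1 := le_meanPacking hP (measurableSet_cube (0 : Fin n → ℝ) L) (isBounded_cube _ _) hv
      (by rwa [hvol])
    have h2 := (ENNReal.ofReal_le_iff_le_toReal (meanPacking_ne_top hP d (measurableSet_cube _ _)
      (isBounded_cube _ _))).1 h1
    rw [hvol] at h2
    rw [le_div_iff₀ (by positivity), mul_comm]
    exact h2
  · have h0 : Tendsto (fun L : ℕ => ((L : ℝ) ^ n)⁻¹) atTop (𝓝 0) := hpow.inv_tendsto_atTop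
    obtain ⟨L, hL, hL1⟩ := ((h0.eventually (gt_mem_nhds hν)).and (eventually_ge_atTop 1)).exists
    -- A cube of side `L` has diameter at most `n * L`, so at this scale it holds at most one point
    -- of a packing and the density is at most `1 / L ^ n`.
    refine ⟨(n * L : ℕ), lt_of_le_of_lt ((hle _ L hL1).trans ?_) hL⟩
    rw [div_eq_mul_inv]
    refine mul_le_of_le_one_left (by positivity) ?_
    refine ENNReal.toReal_le_of_le_ofReal zero_le_one ?_
    rw [ENNReal.ofReal_one]
    refine meanPacking_le_one fun x hx y hy => ?_
    refine (dist_le_of_forall_abs_le hn (l := L) x y fun i => ?_).trans (le_of_eq (by simp))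
    have h1 := hx i
    have h2 := hy i
    simp only [Pi.zero_apply, zero_add] at h1 h2
    rw [abs_le]
    constructor <;> linarith

/-! ### From packing counts to decimated densities -/

theorem packingCount_zero (N : ℝ) (σ : Config n) :
    packingCount 0 N σ = ((σ.1 ∩ box n N).ncard : ℝ) := by
  rw [packingCount, Metric.packingNumber_zero, ← (σ.2 _ (isBounded_box N)).cast_ncard_eq,
    ENat.toENNReal_coe, ENNReal.toReal_natCast]

theorem ncard_le_packingCount {d : ℝ≥0} {N : ℝ} {σ : Config n} {t : Set (Space n)}
    (ht : t ⊆ σ.1 ∩ box n N) (hsep : ∀ x ∈ t, ∀ y ∈ t, x ≠ y → (d : ℝ) < dist x y) :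
    (t.ncard : ℝ) ≤ packingCount d N σ := by
  have htf : t.Finite := (σ.2 _ (isBounded_box N)).subset ht
  have h1 : Metric.IsSeparated (d : ℝ≥0∞) t := fun x hx y hy hxy => by
    have := hsep x hx y hy hxy
    change (d : ℝ≥0∞) < edist x y
    rw [edist_nndist]
    exact_mod_cast this
  have h2 := ENat.toENNReal_le.2 (h1.encard_le_packingNumber ht)
  rw [← htf.cast_ncard_eq, ENat.toENNReal_coe] at h2
  have h3 := ENNReal.toReal_mono (ENat.toENNReal_ne_top.2
    (packingNumber_inter_ne_top d σ (isBounded_box N))) h2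
  rwa [ENNReal.toReal_natCast] at h3

theorem exists_subset_of_le_packingCount {d : ℝ≥0} {N : ℝ} {σ : Config n} {k : ℕ}
    (hk : (k : ℝ) ≤ packingCount d N σ) : ∃ t ⊆ σ.1 ∩ box n N, t.ncard = k ∧
      t.Pairwise fun x y => (d : ℝ) ≤ dist x y := by
  have h1 : (k : ℕ∞) ≤ Metric.packingNumber d (σ.1 ∩ box n N) := by
    rw [← ENat.toENNReal_le, ENat.toENNReal_coe]
    have := ENNReal.ofReal_le_of_le_toReal hk
    rwa [ENNReal.ofReal_natCast] at this
  obtain ⟨x, hx, hinj, hd⟩ := natCast_le_packingNumber_iff.1 h1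
  refine ⟨range x, range_subset_iff.2 hx, ?_, ?_⟩
  · rw [← image_univ, ncard_image_of_injective _ hinj, ncard_univ, Nat.card_eq_fintype_card,
      Fintype.card_fin]
  · rintro _ ⟨i, rfl⟩ _ ⟨j, rfl⟩ hij
    have : (d : ℝ≥0∞) < edist (x i) (x j) := hd fun h => hij (h ▸ rfl)
    rw [edist_nndist] at this
    exact le_of_lt (by exact_mod_cast this)

theorem boxDensity_le_one {N : ℝ} (hN : 0 < N) (s : Set (Space n)) : boxDensity N s ≤ 1 := by
  rw [boxDensity, div_le_one (by positivity)]
  refine ENNReal.toReal_le_of_le_ofReal (by positivity) ((measure_mono inter_subset_right).trans ?_)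
  rw [volume_box, ENNReal.ofReal_pow (by positivity)]

section Limit

variable {σ : Config n}

theorem tendsto_ncard_atTop (hn : 1 ≤ n)
    (h0 : Tendsto (fun N : ℝ => packingCount 0 N σ / (2 * N) ^ n) atTop (𝓝 1)) :
    Tendsto (fun N : ℝ => ((σ.1 ∩ box n N).ncard : ℝ)) atTop atTop := by
  have h1 : Tendsto (fun N : ℝ => (2 * N) ^ n) atTop atTop :=
    (tendsto_pow_atTop (by omega)).comp (tendsto_id.const_mul_atTop two_pos)
  refine (h0.pos_mul_atTop one_pos h1).congr' ?_
  filter_upwards [eventually_gt_atTop 0] with N hN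
  rw [div_mul_cancel₀ _ (by positivity), packingCount_zero]

/-- The allowed error in the number of points has exponent below 1, so it is negligible against the
volume. -/
theorem tendsto_ncard_rpow_div (hn : 1 ≤ n) {ε : ℝ} (hε : ε < 1 / 2)
    (h0 : Tendsto (fun N : ℝ => packingCount 0 N σ / (2 * N) ^ n) atTop (𝓝 1)) :
    Tendsto (fun N : ℝ => ((σ.1 ∩ box n N).ncard : ℝ) ^ (1 / 2 + ε) / (2 * N) ^ n) atTop
      (𝓝 0) := by
  have h1 := (tendsto_rpow_neg_atTop (y := 1 / 2 - ε) (by linarith)).comp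
    (tendsto_ncard_atTop hn h0)
  have h2 := h0.mul h1
  rw [mul_zero] at h2
  refine h2.congr' ?_
  filter_upwards [(tendsto_ncard_atTop hn h0).eventually_gt_atTop 0] with N hN
  rw [packingCount_zero, Function.comp_apply, div_mul_eq_mul_div]
  congr 1
  nth_rewrite 1 [← Real.rpow_one ((σ.1 ∩ box n N).ncard : ℝ)]
  rw [← Real.rpow_add hN]
  congr 1
  ring

/-- When ν is below the packing density at `d`, a packing with ⌊ν|σ_N|⌋ points is available; its
half-spacing balls are disjoint and cover the expected volume up to the shell. -/
theorem eventually_lt_decimatedDensity (hn : 1 ≤ n) {ε ν ι : ℝ} (hε : 0 < ε) {d : ℝ≥0}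
    (hd : 0 < d) (hν : 0 < ν) (hι : ν < ι)
    (h0 : Tendsto (fun N : ℝ => packingCount 0 N σ / (2 * N) ^ n) atTop (𝓝 1))
    (h1 : Tendsto (fun N : ℝ => packingCount d N σ / (2 * N) ^ n) atTop (𝓝 ι)) {c : ℝ}
    (hc : c < ν * ballVol n (d / 2)) :
    ∀ᶠ N : ℝ in atTop, c < decimatedDensity ε ν N σ := by
  have hd' : (0 : ℝ) < d := by exact_mod_cast hd
  have hM := tendsto_ncard_atTop hn h0
  have hpow : Tendsto (fun N : ℝ => (2 * N) ^ n) atTop atTop :=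
    (tendsto_pow_atTop (by omega)).comp (tendsto_id.const_mul_atTop two_pos)
  have hinv : Tendsto (fun N : ℝ => 1 / (2 * N) ^ n) atTop (𝓝 0) :=
    hpow.inv_tendsto_atTop.congr fun N => by simp
  have hshell : Tendsto (fun N : ℝ => ((2 * N + d) ^ n - (2 * N) ^ n) / (2 * N) ^ n) atTop
      (𝓝 0) := by
    have h2 : Tendsto (fun N : ℝ => (d : ℝ) / (2 * N)) atTop (𝓝 0) :=
      tendsto_const_nhds.div_atTop (tendsto_id.const_mul_atTop two_pos)
    have h3 := ((h2.const_add 1).pow n).sub_const 1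
    rw [add_zero, one_pow, sub_self] at h3
    refine h3.congr' ?_
    filter_upwards [eventually_gt_atTop 0] with N hN
    rw [sub_div, div_self (by positivity), ← div_pow]
    congr 2
    field_simp
  have hlow : Tendsto (fun N : ℝ =>
      (ν * (packingCount 0 N σ / (2 * N) ^ n) - 1 / (2 * N) ^ n) * ballVol n (d / 2) -
        ((2 * N + d) ^ n - (2 * N) ^ n) / (2 * N) ^ n) atTop (𝓝 (ν * ballVol n (d / 2))) := by
    have := (((h0.const_mul ν).sub hinv).mul_const (ballVol n (d / 2))).sub hshell
    simpa using this
  have hcmp : ∀ᶠ N : ℝ in atTop,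
      ν * (packingCount 0 N σ / (2 * N) ^ n) < packingCount d N σ / (2 * N) ^ n := by
    have h2 := h1.sub (h0.const_mul ν)
    filter_upwards [h2.eventually (lt_mem_nhds (show (0 : ℝ) < ι - ν * 1 by linarith))] with N hN
    linarith
  filter_upwards [hlow.eventually (lt_mem_nhds hc), hcmp, eventually_gt_atTop 0,
    (hM.const_mul_atTop hν).eventually_ge_atTop 2, hM.eventually_ge_atTop 1] with N hN1 hN2 hN0
    hN3 hN4
  have hNp : 0 < (2 * N) ^ n := by positivity
  rw [← mul_div_assoc, div_lt_div_iff_of_pos_right hNp] at hN2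
  rw [packingCount_zero] at hN1 hN2
  set M : ℝ := ((σ.1 ∩ box n N).ncard : ℝ) with hMdef
  set k := ⌊ν * M⌋₊ with hk
  have hkle : (k : ℝ) ≤ ν * M := Nat.floor_le (by positivity)
  have hklt : ν * M - 1 < k := Nat.sub_one_lt_floor _
  -- Two points are needed for a genuine minimal spacing: `infsep` of a set with at most one point
  -- is 0.
  have hk2 : 2 ≤ k := Nat.le_floor (by exact_mod_cast hN3)
  obtain ⟨t, ht, htk, htsep⟩ := exists_subset_of_le_packingCount (hkle.trans hN2.le)
  -- Rounding down costs less than one point, which the tolerance absorbs.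
  have hpow1 : 1 ≤ M ^ (1 / 2 + ε) := Real.one_le_rpow hN4 (by linarith)
  have hbd : BddAbove {δ : ℝ | ∃ τ : Set (Space n), τ ⊆ σ.1 ∩ box n N ∧
    ν * M - M ^ (1 / 2 + ε) ≤ (τ.ncard : ℝ) ∧
    (τ.ncard : ℝ) ≤ ν * M + M ^ (1 / 2 + ε) ∧ δ = boxDensity N τ} := by
    refine ⟨1, ?_⟩
    rintro _ ⟨τ, -, -, -, rfl⟩
    exact boxDensity_le_one hN0 τ
  have hmem : boxDensity N t ≤ decimatedDensity ε ν N σ :=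
    le_csSup hbd ⟨t, ht, by rw [htk]; linarith, by rw [htk]; linarith, rfl⟩
  refine hN1.trans_le (le_trans ?_ hmem)
  have htb : t ∩ box n N = t := inter_eq_left.2 (ht.trans inter_subset_right)
  have htf : t.Finite := (σ.2 _ (isBounded_box N)).subset ht
  have htn : t.Nontrivial := by
    have := htf.to_subtype
    rw [← one_lt_ncard_iff_nontrivial]
    omega
  have hinf : (d : ℝ) / 2 ≤ t.infsep / 2 := by
    have := htn.le_infsep fun x hx y hy hxy => htsep hx hy hxy
    linarith
  have hvol := le_volume_biUnion_closedBall_inter hn htf hd' hinf hN0.le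
    (ht.trans inter_subset_right) htsep
  rw [boxDensity, htb, htk] at *
  rw [le_div_iff₀ hNp]
  refine le_trans (le_of_eq ?_) (le_trans (sub_le_sub_right (mul_le_mul_of_nonneg_right hklt.le
    (ballVol_nonneg (n := n) (d / 2))) ((2 * N + d) ^ n - (2 * N) ^ n)) hvol)
  field_simp

/-- When ν is above the packing density at `d`, every admissible subset has too many points for a
`d`-packing. Its spacing is therefore at most `d`, and the union bound on volumes applies. -/
theorem eventually_decimatedDensity_lt (hn : 1 ≤ n) {ε ν ι : ℝ} (hε' : ε < 1 / 2)
    {d : ℝ≥0} (hν : 0 < ν) (hι : ι < ν)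
    (h0 : Tendsto (fun N : ℝ => packingCount 0 N σ / (2 * N) ^ n) atTop (𝓝 1))
    (h1 : Tendsto (fun N : ℝ => packingCount d N σ / (2 * N) ^ n) atTop (𝓝 ι)) {c : ℝ}
    (hc : ν * ballVol n (d / 2) < c) :
    ∀ᶠ N : ℝ in atTop, decimatedDensity ε ν N σ < c := by
  have he := tendsto_ncard_rpow_div hn hε' h0
  have hup : Tendsto (fun N : ℝ => (ν * (packingCount 0 N σ / (2 * N) ^ n) +
      ((σ.1 ∩ box n N).ncard : ℝ) ^ (1 / 2 + ε) / (2 * N) ^ n) * ballVol n (d / 2)) atTop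
      (𝓝 (ν * ballVol n (d / 2))) := by
    have := ((h0.const_mul ν).add he).mul_const (ballVol n (d / 2))
    simpa using this
  have hcmp : ∀ᶠ N : ℝ in atTop, packingCount d N σ / (2 * N) ^ n <
      ν * (packingCount 0 N σ / (2 * N) ^ n) -
        ((σ.1 ∩ box n N).ncard : ℝ) ^ (1 / 2 + ε) / (2 * N) ^ n := by
    have h2 := ((h0.const_mul ν).sub he).sub h1
    filter_upwards [h2.eventually (lt_mem_nhds (show (0 : ℝ) < ν * 1 - 0 - ι by linarith))]
      with N hN
    linarith
  filter_upwards [hup.eventually (gt_mem_nhds hc), hcmp, eventually_gt_atTop 0] with N hN1 hN2 hN0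
  have hNp : 0 < (2 * N) ^ n := by positivity
  rw [← mul_div_assoc, ← sub_div, div_lt_div_iff_of_pos_right hNp] at hN2
  rw [packingCount_zero] at hN1 hN2
  refine lt_of_le_of_lt ?_ hN1
  have hv := ballVol_nonneg (n := n) (d / 2)
  -- Nonnegativity of the bound covers the case of no admissible subset, where the supremum is 0 by
  -- default.
  refine Real.sSup_le ?_ (by positivity)
  rintro _ ⟨τ, hτ, hτ1, hτ2, rfl⟩
  have hτf : τ.Finite := (σ.2 _ (isBounded_box N)).subset hτ
  have hτb : τ ∩ box n N = τ := inter_eq_left.2 (hτ.trans inter_subset_right)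
  have hinf : τ.infsep ≤ d := by
    by_contra! hlt
    have := ncard_le_packingCount hτ fun x hx y hy hxy =>
      hlt.trans_le (infsep_le_dist_of_mem hx hy hxy)
    linarith
  rw [boxDensity, hτb, div_le_iff₀ hNp]
  refine (volume_biUnion_closedBall_inter_le hτf _ N).trans ?_
  have h2 := ballVol_mono (n := n) (show 0 ≤ τ.infsep / 2 from div_nonneg infsep_nonneg two_pos.le)
    (show τ.infsep / 2 ≤ d / 2 by linarith)
  calc (τ.ncard : ℝ) * ballVol n (τ.infsep / 2)
      ≤ (ν * ((σ.1 ∩ box n N).ncard : ℝ) + ((σ.1 ∩ box n N).ncard : ℝ) ^ (1 / 2 + ε)) *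
        ballVol n (d / 2) := mul_le_mul hτ2 h2 (ballVol_nonneg _) (by positivity)
    _ = _ := by field_simp

end Limit

end RandomPacking


/-! ### The main theorem -/

theorem theorem4 (n : ℕ) (hn : 1 ≤ n) (ε : ℝ) (hε : 0 < ε) (hε' : ε < 1 / 2)
    (P : Measure (RandomPacking.Config n)) (hP : RandomPacking.IsPoissonField 1 P) :
    ∃ D : ℝ → ℝ,
      (∀ᵐ σ ∂P, ∀ ν : ℝ, 0 < ν → ν < 1 →
        liminf (fun N : ℝ => RandomPacking.decimatedDensity ε ν N σ) atTop = D ν) ∧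
      (∀ d : ℝ, 0 < d → 0 < RandomPacking.nu1 n d →
        (2 : ℝ)⁻¹ ^ n * RandomPacking.ballVol n d * RandomPacking.nu1 n d
          ≤ D (RandomPacking.nu1 n d)) ∧
      (∃ d : ℝ, 0 < d ∧ RandomPacking.ballVol n d = 1 ∧ RandomPacking.nu1 n d = 1 / 2) ∧
      (2 : ℝ)⁻¹ ^ (n + 1) ≤ D (1 / 2) ∧
      (∀ d : ℝ, 0 < d →
        D (RandomPacking.nu2 n d)
          ≤ (2 : ℝ)⁻¹ ^ n * RandomPacking.ballVol n d * RandomPacking.nu2 n d) ∧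
      (∀ d : ℝ, 0 < d → 0 < RandomPacking.nu3 n d →
        (2 : ℝ)⁻¹ ^ n * RandomPacking.ballVol n d * RandomPacking.nu3 n d
          ≤ D (RandomPacking.nu3 n d)) := by
  open RandomPacking in
  obtain ⟨ι, hι, hι0, hmono, hlow, hsmall⟩ := exists_packing_density_function hP hn
  have hstrict : ∀ d' d : ℝ≥0, d' < d → ι d < ι d' := by
    intro d' d hd
    have h1 := hmono d' d hd.le
    have h2 := ballVol_lt hn d'.2 (show (d' : ℝ) < d by exact_mod_cast hd)
    have h3 : 0 < (ballVol n d - ballVol n d') / 2 * Real.exp (-2 * ballVol n d) := by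
      have := sub_pos.2 h2
      positivity
    linarith
  have hnu3 : ∀ d : ℝ≥0, 0 < d → nu3 n d ≤ ι d := fun d hd =>
    (one_sub_sub_le_one_sub_exp_div (ballVol_pos (by exact_mod_cast hd))).trans (hlow d hd)
  -- The limiting spacing is a generalized inverse of `ι`, so continuity of `ι` is not needed.
  set r : ℝ → ℝ≥0 := fun ν => sSup {d | ν ≤ ι d} with hr
  have hbdd : ∀ ν, 0 < ν → BddAbove {d | ν ≤ ι d} := by
    intro ν hν
    obtain ⟨d₀, hd₀⟩ := hsmall ν hν
    refine ⟨d₀, fun d hd => ?_⟩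
    by_contra! hlt
    exact absurd (hd.trans (hstrict _ _ hlt).le) (not_le.2 hd₀)
  have hge : ∀ (ν : ℝ) (d : ℝ≥0), 0 < ν → ν ≤ ι d →
      (2 : ℝ)⁻¹ ^ n * ballVol n d * ν ≤ ν * ballVol n (r ν / 2) := by
    intro ν d hν hd
    have h1 : d ≤ r ν := le_csSup (hbdd ν hν) hd
    have h2 : (d : ℝ) ≤ r ν := by exact_mod_cast h1
    rw [← ballVol_half d.coe_nonneg, mul_comm]
    exact mul_le_mul_of_nonneg_left
      (ballVol_mono (div_nonneg d.coe_nonneg two_pos.le) (by linarith)) hν.le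
  have h3 : ∀ d : ℝ, 0 < d → 0 < nu3 n d →
      (2 : ℝ)⁻¹ ^ n * ballVol n d * nu3 n d ≤ nu3 n d * ballVol n (r (nu3 n d) / 2) :=
    fun d hd hν => hge _ ⟨d, hd.le⟩ hν (hnu3 ⟨d, hd.le⟩ hd)
  have h1 : ∀ d : ℝ, 0 < d → 0 < nu1 n d →
      (2 : ℝ)⁻¹ ^ n * ballVol n d * nu1 n d ≤ nu1 n d * ballVol n (r (nu1 n d) / 2) :=
    fun d hd hν => hge _ ⟨d, hd.le⟩ hν ((nu1_le_nu3 d).trans (hnu3 ⟨d, hd.le⟩ hd))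
  have hhalf : ∃ d : ℝ, 0 < d ∧ ballVol n d = 1 ∧ nu1 n d = 1 / 2 := by
    obtain ⟨d, hd, hv⟩ := exists_ballVol_eq hn one_pos
    exact ⟨d, hd, hv, by rw [nu1, hv]; norm_num⟩
  refine ⟨fun ν => ν * ballVol n (r ν / 2), ?_, h1, hhalf, ?_, ?_, h3⟩
  -- Rational distances suffice, by monotonicity of `ι` and continuity of the ball volume; this
  -- gives one null set that serves every ν at once.
  · have hall : ∀ᵐ σ ∂P, ∀ q : ℚ, Tendsto (fun N : ℝ =>
        packingCount (Real.toNNReal q) N σ / (2 * N) ^ n) atTop (𝓝 (ι (Real.toNNReal q))) :=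
      ae_all_iff.2 fun q => hι _
    filter_upwards [hall] with σ hσ ν hν hν1
    have h0 : Tendsto (fun N : ℝ => packingCount 0 N σ / (2 * N) ^ n) atTop (𝓝 1) := by
      simpa [hι0] using hσ 0
    have hrpos : 0 < r ν := by
      -- This ball volume makes `nu1 n d` equal to ν.
      obtain ⟨d, hd, hv⟩ := exists_ballVol_eq hn (show 0 < 2 * (1 - ν) by linarith)
      have hle : ν ≤ ι ⟨d, hd.le⟩ := by
        refine le_trans ?_ ((nu1_le_nu3 d).trans (hnu3 ⟨d, hd.le⟩ hd))
        rw [nu1, hv]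
        linarith
      exact lt_of_lt_of_le (show (0 : ℝ≥0) < ⟨d, hd.le⟩ from hd) (le_csSup (hbdd ν hν) hle)
    have hcont : Continuous fun x : ℝ => ν * ((x / 2) ^ n * ballVol n 1) := by fun_prop
    have hval : ∀ d : ℝ, 0 ≤ d → ν * ((d / 2) ^ n * ballVol n 1) = ν * ballVol n (d / 2) :=
      fun d hd => by rw [ballVol_eq (r := d / 2) (by positivity)]
    refine Tendsto.liminf_eq (tendsto_order.2 ⟨fun c hc => ?_, fun c hc => ?_⟩)
    · rw [← hval _ (r ν).coe_nonneg] at hc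
      obtain ⟨l, hl, hsub⟩ := exists_Ioc_subset_of_mem_nhds
        (hcont.continuousAt.eventually (lt_mem_nhds hc)) ⟨0, show (0 : ℝ) < r ν from hrpos⟩
      obtain ⟨q, hq1, hq2⟩ := exists_rat_btwn (max_lt (show (0 : ℝ) < r ν from hrpos) hl)
      have hq0 : (0 : ℝ) < q := (le_max_left _ _).trans_lt hq1
      have hqv : ((Real.toNNReal q : ℝ≥0) : ℝ) = q := Real.coe_toNNReal _ hq0.le
      have hqr : Real.toNNReal q < r ν := by
        rw [← NNReal.coe_lt_coe, hqv]
        exact hq2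
      -- Strict decrease of `ι` turns ν ≤ ι(d) with q < d into the strict inequality ν < ι(q) that
      -- the lower estimate needs.
      obtain ⟨d, hd, hqd⟩ := exists_lt_of_lt_csSup' hqr
      have hcq : c < ν * ((q / 2 : ℝ) ^ n * ballVol n 1) :=
        hsub ⟨(le_max_right _ _).trans_lt hq1, hq2.le⟩
      refine eventually_lt_decimatedDensity hn hε (Real.toNNReal_pos.2 hq0) hν
        (lt_of_le_of_lt hd (hstrict _ _ hqd)) h0 (hσ q) ?_
      rwa [hqv, ← hval _ hq0.le]
    · rw [← hval _ (r ν).coe_nonneg] at hc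
      obtain ⟨l, hl, hsub⟩ := exists_Ico_subset_of_mem_nhds
        (hcont.continuousAt.eventually (gt_mem_nhds hc)) ⟨(r ν : ℝ) + 1, lt_add_one _⟩
      obtain ⟨q, hq1, hq2⟩ := exists_rat_btwn hl
      have hq0 : (0 : ℝ) < q := (r ν).2.trans_lt hq1
      have hqv : ((Real.toNNReal q : ℝ≥0) : ℝ) = q := Real.coe_toNNReal _ hq0.le
      have hqr : r ν < Real.toNNReal q := by
        rw [← NNReal.coe_lt_coe, hqv]
        exact hq1
      have hlt : ι (Real.toNNReal q) < ν := by
        by_contra! hle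
        exact absurd (le_csSup (hbdd ν hν) hle) (not_le.2 hqr)
      have hcq : ν * ((q / 2 : ℝ) ^ n * ballVol n 1) < c := hsub ⟨hq1.le, hq2⟩
      refine eventually_decimatedDensity_lt hn hε' hν hlt h0 (hσ q) ?_
      rwa [hqv, ← hval _ hq0.le]
  · obtain ⟨d, hd, hv, hν⟩ := hhalf
    have := h1 d hd (by rw [hν]; norm_num)
    rw [hν, hv] at this
    rw [pow_succ]
    linarith
  · intro d hd
    -- The isolated-pair inequality at `d' = 0`, where `ι` equals 1.
    have hle : ι ⟨d, hd.le⟩ ≤ nu2 n d := by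
      have := hmono 0 ⟨d, hd.le⟩ zero_le
      rw [hι0, NNReal.coe_zero, ballVol_zero hn, sub_zero] at this
      unfold nu2
      change ι ⟨d, hd.le⟩ + ballVol n d / 2 * Real.exp (-2 * ballVol n d) ≤ 1 at this
      linarith
    have hpos : 0 ≤ nu2 n d := by
      refine le_trans ?_ ((hlow ⟨d, hd.le⟩ hd).trans hle)
      refine div_nonneg (sub_nonneg.2 (Real.exp_le_one_iff.2 ?_)) (ballVol_nonneg _)
      exact neg_nonpos.2 (ballVol_nonneg _)
    have hrd : r (nu2 n d) ≤ ⟨d, hd.le⟩ := by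
      -- In `ℝ≥0` the supremum of the empty set is 0, so neither nonemptiness nor positivity of `nu2
      -- n d` is required.
      refine csSup_le' fun d' hd' => ?_
      by_contra hlt
      exact absurd (hle.trans hd') (not_le.2 (hstrict _ _ (not_le.1 hlt)))
    have hrd' : (r (nu2 n d) : ℝ) ≤ d := hrd
    change nu2 n d * ballVol n (r (nu2 n d) / 2) ≤ _
    rw [← ballVol_half hd.le, mul_comm]
    exact mul_le_mul_of_nonneg_right
      (ballVol_mono (div_nonneg (r (nu2 n d)).coe_nonneg two_pos.le) (by linarith)) hpos
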